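/- Let $d\in\mathbb N$, $0\le T<\infty$, and let $\zeta:\mathbb R^d\to[0,\infty)$ be continuous with $\zeta(x)\le C_\zeta(1+\|x\|^p)$ for all $x$, for some $p\in[0,2)$ and $C_\zeta\in(0,\infty)$. For a measure $\nu$ write $\langle\zeta,\nu\rangle=\int\zeta\,d\nu$, and for a function $v$ on $\mathbb R^d$ write $\langle\zeta,v\rangle=\int\zeta(x)v(x)\,dx$. On a probability space let $(B_i)_{i\ge1}$ be i.i.d. standard $d$-dimensional Brownian motions started at $0$, and let $(X_i)_{i\ge1}$ be i.i.d. exponential random variables of rate $1$, independent of $(B_i)_{i\ge1}$. Let $\mathcal M(\mathbb R^d)$ be the space of sub-probability measures on $\mathbb R^d$ with the topology of weak convergence, metrized by the bounded-Lipschitz distance, and let $\mathbb D([0,T]:\mathcal M(\mathbb R^d))$ be the space of right continuous functions with left limits from $[0,T]$ to $\mathcal M(\mathbb R^d)$, with the Skorokhod topology. For every $n\ge1$, almost surely, the equation $$\mu^n(t)=\frac1n\sum_{i=1}^n\delta_{B_i(t)}\mathbf 1_{\{X_i>\int_0^t\langle\zeta,\mu^n(s)\rangle\,ds\}},\qquad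 t\in[0,T],$$ has exactly one solution $\mu^n=\{\mu^n(t)\}_{t\in[0,T]}$ with values in $\mathcal M(\mathbb R^d)$ (and $s\mapsto\langle\zeta,\mu^n(s)\rangle$ integrable on $[0,T]$); it lies in $\mathbb D([0,T]:\mathcal M(\mathbb R^d))$, and each $\mu^n(t)$ is a random measure (measurable up to a null set). For $t\ge0$ let $b(t)=\langle\zeta,\mathrm{Law}(B_1(t))\rangle$, $a(t)=\frac1{1+\int_0^t b(s)\,ds}$ and $\mu(t)=a(t)\,\mathrm{Law}(B_1(t))$. Then $b$ is finite and integrable on bounded intervals, so that $a$ is well defined, $t\mapsto\mu(t)$ is a continuous function from $[0,T]$ to $\mathcal M(\mathbb R^d)$, and, as $n\to\infty$, $$\mu^n\to\mu\quad\text{in probability in }\mathbb D([0,T]:\mathcal M(\mathbb R^d)).$$ Moreover, for every $t>0$ the measure $\mu(t)$ has a density $u(t,\cdot)\ge0$ with respect to Lebesgue measure (for a suitable version of it), and $u$ is a classical ($C^{1,2}$) solution of $$\frac{\partial u}{\partial t}(t,x)=\frac12\Delta u(t,x)-\langle\zeta,u(t,\cdot)\rangle\,u(t,x),\qquad (t,x)\in(0,\infty)\times\mathbb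 R^d,$$ with $\langle\zeta,u(t,\cdot)\rangle<\infty$ for all $t>0$ and $u(t,x)\,dx\to\delta_0$ weakly as $t\downarrow0$. -/

import Mathlib

open MeasureTheory ProbabilityTheory Set Filter Topology
open scoped NNReal ENNReal

noncomputable section

/-! ### Sub-probability measures -/

/-- The space `𝓜(S)` of sub-probability measures on `S`. -/
def SubProb (S : Type*) [MeasurableSpace S] : Type _ :=
  {ν : FiniteMeasure S // ν.mass ≤ 1}

/-- The underlying measure. -/
def SubProb.toMeasure {S : Type*} [MeasurableSpace S] (ν : SubProb S) : Measure S :=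
  (ν.1 : Measure S)

/-- The topology of weak convergence: the coarsest one for which `ν ↦ ∫ f dν` is continuous for all
bounded continuous `f`. -/
instance SubProb.instTopologicalSpace {S : Type*} [MeasurableSpace S] [TopologicalSpace S]
    [OpensMeasurableSpace S] : TopologicalSpace (SubProb S) :=
  TopologicalSpace.induced Subtype.val inferInstance

/-- The bounded-Lipschitz distance
`d_BL(ν₁, ν₂) = sup {|⟨ν₁ - ν₂, f⟩| : ‖f‖_∞ ≤ 1, ‖f‖_L ≤ 1}`. -/
instance SubProb.instEDist {S : Type*} [MeasurableSpace S] [PseudoEMetricSpace S] :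
    EDist (SubProb S) where
  edist ν₁ ν₂ := ⨆ f : {f : S → ℝ // (∀ x, |f x| ≤ 1) ∧ LipschitzWith 1 f},
    ENNReal.ofReal |∫ x, f.1 x ∂ν₁.toMeasure - ∫ x, f.1 x ∂ν₂.toMeasure|

/-! ### The Skorokhod space -/

/-- The space `D([0,T] : S)` of right continuous functions with left limits. -/
structure SkorokhodSpace (T : ℝ≥0) (S : Type*) [TopologicalSpace S] where
  toFun : Icc (0 : ℝ) T → S
  right_cont : ∀ t, ContinuousWithinAt toFun (Ici t) t
  left_lim : ∀ t, ∃ l, Tendsto toFun (𝓝[<] t) (𝓝 l)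

/-- The Skorokhod distance
`inf_λ max (sup_t |λ(t) - t|, sup_t d(x(λ(t)), y(t)))`, over the increasing bijections `λ` of
`[0,T]`; it metrizes the Skorokhod (J1) topology. -/
instance SkorokhodSpace.instEDist (T : ℝ≥0) (S : Type*) [TopologicalSpace S] [EDist S] :
    EDist (SkorokhodSpace T S) where
  edist x y := ⨅ lam : Icc (0 : ℝ) T ≃o Icc (0 : ℝ) T,
    max (⨆ t, edist (lam t) t) (⨆ t, edist (x.toFun (lam t)) (y.toFun t))

/-! ### Brownian motion and the particle system -/

/-- `W` is a standard `d`-dimensional Brownian motion (started at `0`): its coordinates are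
independent standard one-dimensional Brownian motions. -/
structure IsStdBrownian {Ω : Type*} [MeasurableSpace Ω] {d : ℕ}
    (W : ℝ≥0 → Ω → EuclideanSpace ℝ (Fin d)) (P : Measure Ω) : Prop where
  coord : ∀ j, IsBrownianReal (fun t ω => W t ω j) P
  indep : iIndepFun (fun (j : Fin d) ω (t : ℝ≥0) => W t ω j) P

/-- `s ↦ ⟨ζ, m(s)⟩` for a path `m` of measures on `[0,T]` (frozen outside `[0,T]`). -/
def totalRate {E : Type*} [MeasurableSpace E] {T : ℝ≥0} (ζ : E → ℝ)
    (m : Icc (0 : ℝ) T → SubProb E) (s : ℝ) : ℝ :=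
  ∫ x, ζ x ∂(m (projIcc 0 (T : ℝ) T.2 s)).toMeasure

/-- The path `m : [0,T] → 𝓜(E)` solves
`m(t) = (1/n) ∑_{i<n} δ_{b_i(t)} 1{x_i > ∫_0^t ⟨ζ, m(s)⟩ ds}` for `t ∈ [0,T]`,
the integral being a well-defined Lebesgue integral. -/
structure SolvesKilling {E : Type*} [MeasurableSpace E] {T : ℝ≥0} (ζ : E → ℝ) (n : ℕ)
    (b : ℕ → ℝ≥0 → E) (x : ℕ → ℝ) (m : Icc (0 : ℝ) T → SubProb E) : Prop where
  integrable : IntervalIntegrable (totalRate ζ m) volume 0 T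
  eq : ∀ t : Icc (0 : ℝ) T, (m t).toMeasure =
    (n : ℝ≥0∞)⁻¹ • ∑ i ∈ Finset.range n,
      if ∫ s in (0 : ℝ)..t, totalRate ζ m s < x i
        then Measure.dirac (b i (t : ℝ).toNNReal) else 0

/-! ### The limit -/

/-- The law of `W(t)`, for a process `W` and a real time `t ≥ 0`. -/
def marginalLaw {Ω E : Type*} [MeasurableSpace Ω] [MeasurableSpace E] (P : Measure Ω)
    (W : ℝ≥0 → Ω → E) (t : ℝ) : Measure E :=
  P.map (W t.toNNReal)

/-- `a(t) = 1 / (1 + ∫_0^t ⟨ζ, w(s)⟩ ds)` for a flow `w` of measures. -/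
def survivalFactor {E : Type*} [MeasurableSpace E] (ζ : E → ℝ) (w : ℝ → Measure E) (t : ℝ) : ℝ :=
  1 / (1 + ∫ s in (0 : ℝ)..t, ∫ x, ζ x ∂(w s))

/-- `a(t) w(t)`. -/
def limitMeasure {E : Type*} [MeasurableSpace E] (ζ : E → ℝ) (w : ℝ → Measure E) (t : ℝ) :
    Measure E :=
  ENNReal.ofReal (survivalFactor ζ w t) • w t

open scoped Laplacian in
/-- `u` is a nonnegative classical (`C^{1,2}`) solution on `(0,∞) × E` of
`∂u/∂t = ½ Δu - ⟨ζ, u⟩ u` with `u(t,·) → δ_0` weakly as `t ↓ 0`. -/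
structure SolvesReactionDiffusion {E : Type*} [NormedAddCommGroup E] [InnerProductSpace ℝ E]
    [FiniteDimensional ℝ E] [MeasurableSpace E] [BorelSpace E]
    (ζ : E → ℝ) (u : ℝ → E → ℝ) : Prop where
  nonneg : ∀ t, 0 < t → ∀ x, 0 ≤ u t x
  contDiff_space : ∀ t, 0 < t → ContDiff ℝ 2 (u t)
  continuousOn_space : ∀ k ≤ 2,
    ContinuousOn (fun q : ℝ × E => iteratedFDeriv ℝ k (u q.1) q.2) (Ioi 0 ×ˢ univ)
  continuousOn_time :
    ContinuousOn (fun q : ℝ × E => deriv (fun s => u s q.2) q.1) (Ioi 0 ×ˢ univ)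
  integrable : ∀ t, 0 < t → Integrable (u t)
  integrable_rate : ∀ t, 0 < t → Integrable (fun y => ζ y * u t y)
  pde : ∀ t, 0 < t → ∀ x, HasDerivAt (fun s => u s x)
    ((1 / 2 : ℝ) * (Δ (u t)) x - (∫ y, ζ y * u t y) * u t x) t
  initial : ∀ f : BoundedContinuousFunction E ℝ,
    Tendsto (fun t => ∫ x, f x * u t x) (𝓝[>] 0) (𝓝 (f 0))

end

/-! The particle system is driven by one scalar, the clock `A(t) = ∫_0^t ⟨ζ, μⁿ(s)⟩ ds`, which
solves `A(t) = ∫_0^t F(s, A(s)) ds` with `F(s, a) = (1/n) ∑ ζ(B_i(s)) 1{a < X_i}`. This `F` jumps in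
`a`, so Lipschitz theory does not apply, but it is nonincreasing in `a`. Existence follows by
letting the particles die in the order of their thresholds (`exists_killingClock`), and monotonicity
gives uniqueness (`killingClock_unique`) and stability with constant one, without Gronwall.

Positions and thresholds are independent, so `E F(s, a) = b(s) e^{-a}`. The averaged equation `Λ' =
b e^{-Λ}` is solved by `Λ = log(1 + ∫ b)`, and `e^{-Λ}` is the survival factor of the theorem. By
monotonicity, `|A - Λ|` on `[0,T]` is at most `∫_0^T |F(s, Λ(s)) - b(s) e^{-Λ(s)}| ds`
(`IsKillingClock.abs_sub_limitClock_le`). Here the clock is deterministic, so the integrand is the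
error in an average of pairwise independent variables, and a variance bound gives the rate
`n^{-1/2}` (`ParticleModel.lintegral_clockError_le`).

To pass from clocks to measures, the averages of `f(B_i(t)) 1{c < X_i}` are controlled uniformly in
the bounded-Lipschitz `f`, in `t ∈ [0,T]` and in `c ≥ 0` (`ParticleModel.exists_uniform_lln`). The
uniformity allows `c` to be the random value `A(t)`. Together these bound the bounded-Lipschitz
distance uniformly in time, hence the Skorokhod distance with the identity time change.

The density of the limit is a survival factor times the heat kernel. The equation is the product
rule: the kernel solves the heat equation, and `a' = -b a² = -⟨ζ, u⟩ a`. -/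

/-! ### Comparison for integral equations -/

/-- Start from the last time `c` at which `D ≤ 0`: afterwards `D` is positive, so its increments are
controlled by `r`. Since the bound on `k` is needed only where `D > 0`, a monotone right-hand side
can take the place of a Lipschitz one. -/
theorem le_integral_of_le_of_pos {D k r : ℝ → ℝ} {a b : ℝ} (hab : a ≤ b)
    (hk : IntervalIntegrable k volume a b) (hr : IntervalIntegrable r volume a b)
    (hD : ∀ t ∈ Icc a b, D t = D a + ∫ s in a..t, k s) (h0 : D a ≤ 0)
    (hr0 : ∀ s ∈ Icc a b, 0 ≤ r s) (hkr : ∀ s ∈ Icc a b, 0 < D s → k s ≤ r s) :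
    D b ≤ ∫ s in a..b, r s := by
  have hcont : ContinuousOn D (Icc a b) := by
    have h1 := intervalIntegral.continuousOn_primitive_interval' hk left_mem_uIcc
    rw [uIcc_of_le hab] at h1
    exact (continuousOn_const.add h1).congr hD
  set S : Set ℝ := Icc a b ∩ D ⁻¹' Iic 0 with hS
  have hSc : IsCompact S :=
    isCompact_Icc.of_isClosed_subset (hcont.preimage_isClosed_of_isClosed isClosed_Icc isClosed_Iic)
      inter_subset_left
  have hSn : S.Nonempty := ⟨a, left_mem_Icc.2 hab, h0⟩
  obtain ⟨⟨h1, h2⟩, h3⟩ := hSc.sSup_mem hSn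
  set c := sSup S with hc
  have hpos : ∀ s ∈ Ioo c b, 0 < D s := by
    intro s hs
    by_contra hneg
    have : s ∈ S := ⟨⟨h1.trans hs.1.le, hs.2.le⟩, not_lt.1 hneg⟩
    exact absurd (le_csSup hSc.bddAbove this) (not_le.2 hs.1)
  have sub1 : uIcc c b ⊆ uIcc a b := by
    rw [uIcc_of_le hab, uIcc_of_le h2]; exact Icc_subset_Icc_left h1
  have sub2 : uIcc a c ⊆ uIcc a b := by
    rw [uIcc_of_le hab, uIcc_of_le h1]; exact Icc_subset_Icc_right h2
  have e1 : D b = D c + ∫ s in c..b, k s := by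
    rw [hD b (right_mem_Icc.2 hab), hD c ⟨h1, h2⟩, add_assoc,
      intervalIntegral.integral_add_adjacent_intervals (hk.mono_set sub2) (hk.mono_set sub1)]
  have e2 : ∫ s in c..b, k s ≤ ∫ s in c..b, r s := by
    refine intervalIntegral.integral_mono_on_of_le_Ioo h2 (hk.mono_set sub1) (hr.mono_set sub1) ?_
    intro s hs
    exact hkr s ⟨h1.trans hs.1.le, hs.2.le⟩ (hpos s hs)
  have e3 : ∫ s in a..b, r s = (∫ s in a..c, r s) + ∫ s in c..b, r s :=
    (intervalIntegral.integral_add_adjacent_intervals (hr.mono_set sub2) (hr.mono_set sub1)).symm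
  have e4 : 0 ≤ ∫ s in a..c, r s :=
    intervalIntegral.integral_nonneg h1 fun s hs => hr0 s ⟨hs.1, hs.2.trans h2⟩
  have e5 : D c ≤ 0 := h3
  linarith

/-! ### The killing clock -/

/-- The total rate at time `s`, when exactly the particles with threshold above `a` are alive. -/
noncomputable def killingRate {ι : Type*} (S : Finset ι) (g : ι → ℝ → ℝ) (x : ι → ℝ) (s a : ℝ) : ℝ :=
  ∑ i ∈ S, if a < x i then g i s else 0

section KillingRate

variable {ι : Type*} {S : Finset ι} {g : ι → ℝ → ℝ} {x : ι → ℝ}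

theorem killingRate_nonneg (hg0 : ∀ i s, 0 ≤ g i s) (s a : ℝ) : 0 ≤ killingRate S g x s a :=
  Finset.sum_nonneg fun i _ => by split_ifs <;> simp [hg0]

theorem killingRate_le (hg0 : ∀ i s, 0 ≤ g i s) (s a : ℝ) :
    killingRate S g x s a ≤ ∑ i ∈ S, g i s :=
  Finset.sum_le_sum fun i _ => by split_ifs <;> simp [hg0]

/-- A larger clock value leaves fewer particles alive. All comparison arguments for clocks rest on
this. -/
theorem killingRate_antitone (hg0 : ∀ i s, 0 ≤ g i s) (s : ℝ) :
    Antitone (killingRate S g x s) := by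
  intro a b hab
  refine Finset.sum_le_sum fun i _ => ?_
  by_cases hb : b < x i
  · simp [hb, hab.trans_lt hb]
  · rw [if_neg hb]; split_ifs <;> simp [hg0]

theorem measurable_killingRate (hg : ∀ i, Continuous (g i)) {A : ℝ → ℝ} (hA : Measurable A) :
    Measurable fun s => killingRate S g x s (A s) :=
  Finset.measurable_sum _ fun i _ =>
    Measurable.ite (measurableSet_lt hA measurable_const) (hg i).measurable measurable_const

theorem intervalIntegrable_killingRate (hg : ∀ i, Continuous (g i)) (hg0 : ∀ i s, 0 ≤ g i s)
    {A : ℝ → ℝ} (hA : Measurable A) (a b : ℝ) :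
    IntervalIntegrable (fun s => killingRate S g x s (A s)) volume a b := by
  have h : Continuous fun s => ∑ i ∈ S, g i s := continuous_finsetSum _ fun i _ => hg i
  refine (h.intervalIntegrable a b).mono_fun'
    (measurable_killingRate hg hA).aestronglyMeasurable (ae_of_all _ fun s => ?_)
  simp only [Real.norm_of_nonneg (killingRate_nonneg hg0 _ _)]
  exact killingRate_le hg0 _ _

/-- Induction on the particles, adding one with the lowest threshold. Until it dies everybody is
alive and the clock is an explicit integral; afterwards the remaining system restarts from that time
and level, hence the arbitrary starting point `(τ, a)`. -/
theorem exists_killingClock (S : Finset ι) (hg : ∀ i, Continuous (g i))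
    (hg0 : ∀ i s, 0 ≤ g i s) : ∀ τ a : ℝ, ∃ A : ℝ → ℝ, Continuous A ∧ Monotone A ∧
      (∀ t ≤ τ, A t = a) ∧
      ∀ t, τ ≤ t → A t = a + ∫ s in τ..t, killingRate S g x s (A s) := by
  classical
  induction S using Finset.induction_on_min_value x with
  | empty => exact fun τ a => ⟨fun _ => a, continuous_const, monotone_const, by simp,
      by simp [killingRate]⟩
  | @insert m S hm hmin ih =>
    intro τ a
    have hins : ∀ s c, killingRate (insert m S) g x s c
        = (if c < x m then g m s else 0) + killingRate S g x s c := fun s c => by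
      rw [killingRate, Finset.sum_insert hm, killingRate]
    -- If `x m ≤ a`, the new particle is dead from the start and contributes nothing.
    rcases le_or_gt (x m) a with hxa | hxa
    · obtain ⟨A, hA1, hA2, hA3, hA4⟩ := ih τ a
      refine ⟨A, hA1, hA2, hA3, fun t ht => ?_⟩
      rw [hA4 t ht]
      congr 1
      refine intervalIntegral.integral_congr fun s hs => ?_
      rw [uIcc_of_le ht] at hs
      have : ¬ A s < x m := not_lt.2 (hxa.trans ((hA3 τ le_rfl).symm.le.trans (hA2 hs.1)))
      simp only [hins, this, if_false, zero_add]
    · set f : ℝ → ℝ := fun s => ∑ i ∈ insert m S, g i s with hf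
      have hfc : Continuous f := continuous_finsetSum _ fun i _ => hg i
      have hf0 : ∀ s, 0 ≤ f s := fun s => Finset.sum_nonneg fun i _ => hg0 i s
      -- The clock as long as nobody has died; `max t τ` freezes it at `a` before `τ`.
      set G : ℝ → ℝ := fun t => a + ∫ s in τ..(max t τ), f s with hG
      have hGc : Continuous G :=
        continuous_const.add ((intervalIntegral.continuous_primitive
          (fun _ _ => hfc.intervalIntegrable _ _) τ).comp (continuous_id.max continuous_const))
      have hGm : Monotone G := by
        intro s t hst
        have := intervalIntegral.integral_mono_interval (μ := volume) (f := f) (c := τ) (a := τ)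
          (b := max s τ) (d := max t τ) le_rfl (le_max_right _ _) (max_le_max_right τ hst)
          (ae_of_all _ hf0) (hfc.intervalIntegrable _ _)
        simpa [hG] using this
      have hG0 : ∀ t ≤ τ, G t = a := fun t ht => by simp [hG, max_eq_right ht]
      have hfull : ∀ s c, c < x m → killingRate (insert m S) g x s c = f s := by
        intro s c hc
        refine Finset.sum_congr rfl fun i hi => ?_
        rcases Finset.mem_insert.1 hi with rfl | hi
        · simp [hc]
        · simp [hc.trans_le (hmin i hi)]
      by_cases hex : ∃ t, τ ≤ t ∧ x m ≤ G t
      · obtain ⟨t1, ht1, hxt1⟩ := hex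
        obtain ⟨σ, ⟨hσ1, hσ2⟩, hσ3⟩ : ∃ σ, IsLeast {t | τ ≤ t ∧ x m ≤ G t} σ := by
          have hcl : IsClosed {t | τ ≤ t ∧ x m ≤ G t} :=
            isClosed_Ici.inter (isClosed_le continuous_const hGc)
          exact ⟨_, hcl.isLeast_csInf ⟨t1, ht1, hxt1⟩ ⟨τ, fun t ht => ht.1⟩⟩
        have hlt : ∀ t < σ, G t < x m := by
          intro t ht
          by_contra hcon
          rcases le_total τ t with h | h
          · exact absurd (hσ3 ⟨h, not_lt.1 hcon⟩) (not_le.2 ht)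
          · rw [hG0 t h] at hcon; exact hcon hxa
        have hGσ : G σ = x m := by
          refine le_antisymm ?_ hσ2
          refine le_of_tendsto (hGc.continuousWithinAt (s := Iio σ) (x := σ)) ?_
          filter_upwards [self_mem_nhdsWithin] with t ht using (hlt t ht).le
        obtain ⟨A, hA1, hA2, hA3, hA4⟩ := ih σ (x m)
        -- Gluing by a sum: before `σ` the second term vanishes, after `σ` the first is constant.
        -- Continuity and monotonicity are then inherited without a case split.
        have hle : ∀ t ≤ σ, min (G t) (x m) + (A t - x m) = G t := fun t ht => by
          rw [hA3 t ht, min_eq_left ((hGm ht).trans hGσ.le)]; ring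
        have hge : ∀ t, σ ≤ t → min (G t) (x m) + (A t - x m) = A t := fun t ht => by
          rw [min_eq_right (hGσ.symm.le.trans (hGm ht))]; ring
        have hc' : Continuous fun t => min (G t) (x m) + (A t - x m) :=
          (hGc.min continuous_const).add (hA1.sub continuous_const)
        refine ⟨fun t => min (G t) (x m) + (A t - x m), hc', fun s t hst => ?_, fun t ht => ?_,
          fun t ht => ?_⟩
        · have := hA2 hst
          have := min_le_min_right (x m) (hGm hst)
          dsimp only; linarith
        · exact (hle t (ht.trans hσ1)).trans (hG0 t ht)
        have key1 : ∀ u, τ ≤ u → u ≤ σ → ∫ s in τ..u, killingRate (insert m S) g x s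
            (min (G s) (x m) + (A s - x m)) = ∫ s in τ..u, f s := by
          intro u hu huσ
          refine intervalIntegral.integral_congr_Ioo_of_le hu fun s hs => ?_
          rw [hle s (hs.2.le.trans huσ)]
          exact hfull s _ (hlt s (hs.2.trans_le huσ))
        rcases le_total t σ with h | h
        · simp only
          rw [hle t h, key1 t ht h]
          simp [hG, max_eq_left ht]
        · have hint := fun p q => intervalIntegrable_killingRate (S := insert m S) (x := x) hg hg0
            hc'.measurable p q
          simp only
          rw [hge t h, ← intervalIntegral.integral_add_adjacent_intervals (hint τ σ) (hint σ t),
            key1 σ hσ1 le_rfl, hA4 t h]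
          have e1 : a + ∫ s in τ..σ, f s = x m := by rw [← hGσ]; simp [hG, max_eq_left hσ1]
          rw [← add_assoc, e1]
          congr 1
          refine intervalIntegral.integral_congr fun s hs => ?_
          rw [uIcc_of_le h] at hs
          rw [hge s hs.1, hins, if_neg, zero_add]
          exact not_lt.2 ((hA3 σ le_rfl).symm.le.trans (hA2 hs.1))
      · push Not at hex
        refine ⟨G, hGc, hGm, hG0, fun t ht => ?_⟩
        have : G t = a + ∫ s in τ..t, f s := by simp [hG, max_eq_left ht]
        rw [this]
        congr 1
        refine intervalIntegral.integral_congr fun s hs => ?_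
        rw [uIcc_of_le ht] at hs
        exact (hfull s _ (hex s hs.1)).symm

/-- Where one clock is ahead, its rate is no larger than that of the other. The comparison lemma
with `r = 0` then keeps it from getting ahead, and the roles are symmetric. -/
theorem killingClock_unique {T : ℝ} (hg0 : ∀ i s, 0 ≤ g i s)
    {A A' : ℝ → ℝ}
    (hi : IntervalIntegrable (fun s => killingRate S g x s (A s)) volume 0 T)
    (hi' : IntervalIntegrable (fun s => killingRate S g x s (A' s)) volume 0 T)
    (hA : ∀ t ∈ Icc 0 T, A t = ∫ s in (0 : ℝ)..t, killingRate S g x s (A s))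
    (hA' : ∀ t ∈ Icc 0 T, A' t = ∫ s in (0 : ℝ)..t, killingRate S g x s (A' s)) :
    ∀ t ∈ Icc 0 T, A t = A' t := by
  suffices H : ∀ {A A' : ℝ → ℝ},
      IntervalIntegrable (fun s => killingRate S g x s (A s)) volume 0 T →
      IntervalIntegrable (fun s => killingRate S g x s (A' s)) volume 0 T →
      (∀ t ∈ Icc 0 T, A t = ∫ s in (0 : ℝ)..t, killingRate S g x s (A s)) →
      (∀ t ∈ Icc 0 T, A' t = ∫ s in (0 : ℝ)..t, killingRate S g x s (A' s)) →
      ∀ t ∈ Icc 0 T, A t ≤ A' t from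
    fun t ht => le_antisymm (H hi hi' hA hA' t ht) (H hi' hi hA' hA t ht)
  intro A A' hi hi' hA hA' t ht
  have hsub : uIcc 0 t ⊆ uIcc 0 T := by
    rw [uIcc_of_le ht.1, uIcc_of_le (ht.1.trans ht.2)]; exact Icc_subset_Icc_right ht.2
  have h0 : (0 : ℝ) ∈ Icc 0 T := ⟨le_rfl, ht.1.trans ht.2⟩
  have := le_integral_of_le_of_pos (D := fun s => A s - A' s) (r := fun _ => 0) ht.1
    ((hi.sub hi').mono_set hsub) (by simp)
    (fun s hs => by
      have hs' : s ∈ Icc 0 T := ⟨hs.1, hs.2.trans ht.2⟩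
      have hsub' : uIcc 0 s ⊆ uIcc 0 T := by
        rw [uIcc_of_le hs'.1, uIcc_of_le (ht.1.trans ht.2)]; exact Icc_subset_Icc_right hs'.2
      rw [hA s hs', hA' s hs', hA 0 h0, hA' 0 h0]
      simp [intervalIntegral.integral_sub (hi.mono_set hsub') (hi'.mono_set hsub')])
    (by simp [hA 0 h0, hA' 0 h0]) (by simp)
    (fun s _ hpos => by
      have : A' s ≤ A s := by linarith
      simpa using killingRate_antitone hg0 s this)
  simp at this
  exact this

/-! ### Euler approximation of the clock, used for its measurability -/

/-- The Euler scheme with step `δ` for the killing clock. -/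
noncomputable def eulerClock (S : Finset ι) (g : ι → ℝ → ℝ) (x : ι → ℝ) (δ : ℝ) : ℕ → ℝ
  | 0 => 0
  | j + 1 => eulerClock S g x δ j +
      ∫ s in (j * δ)..((j + 1 : ℕ) * δ), killingRate S g x s (eulerClock S g x δ j)

/-- Freezing the clock at the left endpoint overestimates the rate, so the scheme stays above the
true clock. Errors do not accumulate: if the frozen value exceeds the clock throughout the step, the
scheme moves no faster than the clock and the gap cannot grow; otherwise the new gap is at most one
step's increment, `M * δ`. -/
theorem eulerClock_bounds (hg : ∀ i, Continuous (g i)) (hg0 : ∀ i s, 0 ≤ g i s)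
    {A : ℝ → ℝ} (hAc : Continuous A) (hAm : Monotone A)
    (hA : ∀ t, 0 ≤ t → A t = ∫ s in (0 : ℝ)..t, killingRate S g x s (A s))
    {δ T M : ℝ} (hδ : 0 ≤ δ) (hM : ∀ s ∈ Icc 0 T, ∑ i ∈ S, g i s ≤ M) (hM0 : 0 ≤ M) (j : ℕ)
    (hj : j * δ ≤ T) :
    A (j * δ) ≤ eulerClock S g x δ j ∧ eulerClock S g x δ j ≤ A (j * δ) + M * δ := by
  induction j with
  | zero =>
    have : A 0 = 0 := by simpa using hA 0 le_rfl
    simpa [eulerClock, this] using mul_nonneg hM0 hδ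
  | succ j ih =>
    have hle : (j : ℝ) * δ ≤ (j + 1 : ℕ) * δ := by push_cast; nlinarith
    have hj0 : 0 ≤ (j : ℝ) * δ := by positivity
    obtain ⟨ih1, ih2⟩ := ih (hle.trans hj)
    rw [eulerClock]
    set e := eulerClock S g x δ j
    set p := (j : ℝ) * δ with hp
    set q := ((j + 1 : ℕ) : ℝ) * δ with hq
    have hqp : q - p = δ := by rw [hp, hq]; push_cast; ring
    have hiA := fun u v => intervalIntegrable_killingRate (S := S) (x := x) hg hg0
            hAc.measurable u v
    have hie := fun u v => intervalIntegrable_killingRate (S := S) (x := x) hg hg0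
            (measurable_const (a := e)) u v
    have hinc : ∀ t, p ≤ t → A t = A p + ∫ s in p..t, killingRate S g x s (A s) := by
      intro t ht
      rw [hA t (hj0.trans ht), hA p hj0,
        intervalIntegral.integral_add_adjacent_intervals (hiA _ _) (hiA _ _)]
    constructor
    · have := le_integral_of_le_of_pos (D := fun s => A s - e)
        (r := fun s => killingRate S g x s e) hle (hiA _ _) (hie _ _)
        (fun t ht => by rw [hinc t ht.1]; ring) (by linarith)
        (fun s _ => killingRate_nonneg hg0 _ _)
        (fun s _ hpos => killingRate_antitone hg0 s (by linarith))
      linarith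
    -- Either the true clock catches up with `e` by time `q`, or it stays below `e` on the whole
    -- step.
    · rcases le_total e (A q) with h | h
      · have : ∫ s in p..q, killingRate S g x s e ≤ ∫ s in p..q, M := by
          refine intervalIntegral.integral_mono_on hle (hie _ _) intervalIntegrable_const fun s hs => ?_
          exact (killingRate_le hg0 _ _).trans (hM s ⟨hj0.trans hs.1, hs.2.trans hj⟩)
        rw [intervalIntegral.integral_const, hqp, smul_eq_mul] at this
        linarith
      · have : ∫ s in p..q, killingRate S g x s e ≤ ∫ s in p..q, killingRate S g x s (A s) := by
          refine intervalIntegral.integral_mono_on hle (hie _ _) (hiA _ _) fun s hs => ?_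
          exact killingRate_antitone hg0 s ((hAm hs.2).trans h)
        rw [hinc q hle]
        linarith

/-- With step `t / (k + 1)` the grid ends exactly at `t` after `k + 1` steps. This exhibits the
clock as a limit of quantities built from finitely many integrals. -/
theorem tendsto_eulerClock (hg : ∀ i, Continuous (g i)) (hg0 : ∀ i s, 0 ≤ g i s)
    {A : ℝ → ℝ} (hAc : Continuous A) (hAm : Monotone A)
    (hA : ∀ t, 0 ≤ t → A t = ∫ s in (0 : ℝ)..t, killingRate S g x s (A s))
    {t : ℝ} (ht : 0 ≤ t) :
    Tendsto (fun k : ℕ => eulerClock S g x (t / (k + 1 : ℕ)) (k + 1)) atTop (𝓝 (A t)) := by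
  have hc : Continuous fun s => ∑ i ∈ S, g i s := continuous_finsetSum _ fun i _ => hg i
  obtain ⟨M, hM⟩ := (isCompact_Icc (a := (0 : ℝ)) (b := t)).bddAbove_image hc.continuousOn
  have hM' : ∀ s ∈ Icc 0 t, ∑ i ∈ S, g i s ≤ M := fun s hs => hM (mem_image_of_mem _ hs)
  have hM0 : 0 ≤ M := (Finset.sum_nonneg fun i _ => hg0 i 0).trans (hM' 0 ⟨le_rfl, ht⟩)
  have key : ∀ k : ℕ, ((k + 1 : ℕ) : ℝ) * (t / (k + 1 : ℕ)) = t := fun k => by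
    field_simp
  have hb := fun k : ℕ => eulerClock_bounds (S := S) (x := x) hg hg0 hAc hAm hA
    (δ := t / (k + 1 : ℕ)) (by positivity) hM' hM0 (k + 1) (key k).le
  simp only [key] at hb
  refine tendsto_of_tendsto_of_tendsto_of_le_of_le tendsto_const_nhds ?_ (fun k => (hb k).1)
    (fun k => (hb k).2)
  have : Tendsto (fun k : ℕ => A t + M * (t / ((k + 1 : ℕ) : ℝ))) atTop (𝓝 (A t + M * 0)) :=
    (((tendsto_const_div_atTop_nhds_zero_nat t).comp (tendsto_add_atTop_nat 1)).const_mul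
      M).const_add _
  simpa using this

end KillingRate

/-! ### Sub-probability measures -/

namespace SubProb

section Basic

variable {S : Type*} [MeasurableSpace S]

theorem toMeasure_injective : Function.Injective (toMeasure : SubProb S → Measure S) :=
  fun _ _ h => Subtype.ext (FiniteMeasure.toMeasure_injective h)

/-- A measure of mass at most `1`, as a sub-probability measure. -/
def ofMeasure (μ : Measure S) (h : μ univ ≤ 1) : SubProb S :=
  ⟨⟨μ, ⟨h.trans_lt ENNReal.one_lt_top⟩⟩,
    ENNReal.coe_le_coe.1 (FiniteMeasure.ennreal_mass.trans_le h)⟩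

@[simp] theorem toMeasure_ofMeasure (μ : Measure S) (h : μ univ ≤ 1) :
    (ofMeasure μ h).toMeasure = μ := rfl

theorem tendsto_iff [TopologicalSpace S] [OpensMeasurableSpace S] {γ : Type*} {F : Filter γ}
    {ν : γ → SubProb S} {ν₀ : SubProb S} :
    Tendsto ν F (𝓝 ν₀) ↔ ∀ f : BoundedContinuousFunction S ℝ,
      Tendsto (fun c => ∫ y, f y ∂(ν c).toMeasure) F (𝓝 (∫ y, f y ∂ν₀.toMeasure)) := by
  have h : IsInducing (Subtype.val : SubProb S → FiniteMeasure S) := ⟨rfl⟩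
  exact h.tendsto_nhds_iff.trans FiniteMeasure.tendsto_iff_forall_integral_tendsto

end Basic

end SubProb

/-! ### Empirical measures of the surviving particles -/

/-- `(1/n) ∑_{i<n} δ_{y_i} 1{p i}`. -/
noncomputable def aliveMeasure {E : Type*} [MeasurableSpace E] (n : ℕ) (y : ℕ → E) (p : ℕ → Prop)
    [DecidablePred p] : Measure E :=
  (n : ℝ≥0∞)⁻¹ • ∑ i ∈ Finset.range n, if p i then Measure.dirac (y i) else 0

section AliveMeasure

variable {E : Type*} [MeasurableSpace E]

theorem aliveMeasure_univ_le (n : ℕ) (y : ℕ → E) (p : ℕ → Prop) [DecidablePred p] :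
    aliveMeasure n y p univ ≤ 1 := by
  have h : ∑ i ∈ Finset.range n, (if p i then Measure.dirac (y i) else 0 : Measure E) univ ≤ n := by
    calc _ ≤ ∑ i ∈ Finset.range n, (1 : ℝ≥0∞) :=
          Finset.sum_le_sum fun i _ => by split_ifs <;> simp
      _ = n := by simp
  simp only [aliveMeasure, Measure.smul_apply, Measure.coe_finsetSum, Finset.sum_apply,
    smul_eq_mul]
  exact (mul_le_mul_right h _).trans (ENNReal.inv_mul_le_one _)

theorem integral_aliveMeasure [MeasurableSingletonClass E] (n : ℕ) (y : ℕ → E) (p : ℕ → Prop)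
    [DecidablePred p] (f : E → ℝ) :
    ∫ z, f z ∂(aliveMeasure n y p) =
      ∑ i ∈ Finset.range n, if p i then (n : ℝ)⁻¹ * f (y i) else 0 := by
  rw [aliveMeasure, integral_smul_measure, integral_finsetSum_measure]
  · simp only [ENNReal.toReal_inv, ENNReal.toReal_natCast, smul_eq_mul, Finset.mul_sum]
    refine Finset.sum_congr rfl fun i _ => ?_
    split_ifs <;> simp
  · intro i _
    split_ifs
    · exact integrable_dirac (by simp)
    · exact integrable_zero_measure

theorem measurable_aliveMeasure {Ω : Type*} [MeasurableSpace Ω] (n : ℕ) {y : ℕ → Ω → E}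
    (hy : ∀ i, Measurable (y i)) {p : ℕ → Ω → Prop} [∀ ω, DecidablePred fun i => p i ω]
    (hp : ∀ i, MeasurableSet {ω | p i ω}) :
    Measurable fun ω => aliveMeasure n (fun i => y i ω) (fun i => p i ω) := by
  refine Measure.measurable_of_measurable_coe _ fun s hs => ?_
  simp only [aliveMeasure, Measure.smul_apply, Measure.coe_finsetSum, Finset.sum_apply,
    smul_eq_mul]
  refine (Finset.measurable_sum _ fun i _ => ?_).const_mul _
  have h : Measurable fun ω => (if p i ω then Measure.dirac (y i ω) else 0 : Measure E) :=
    Measurable.ite (hp i) (Measure.measurable_dirac.comp (hy i)) measurable_const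
  exact (Measure.measurable_coe hs).comp h

end AliveMeasure

/-! ### The particle system is driven by the killing clock -/

/-- `A` solves `A(t) = ∫_0^t ∑_i g_i(s) 1{A(s) < x_i} ds`. -/
structure IsKillingClock {ι : Type*} (S : Finset ι) (g : ι → ℝ → ℝ) (x : ι → ℝ) (A : ℝ → ℝ) :
    Prop where
  continuous : Continuous A
  monotone : Monotone A
  eq : ∀ t, 0 ≤ t → A t = ∫ s in (0 : ℝ)..t, killingRate S g x s (A s)

/-- The contribution of the particle `i` to `⟨ζ, μⁿ(s)⟩` as long as it is alive. -/
noncomputable def particleRate {E : Type*} (ζ : E → ℝ) (n : ℕ) (b : ℕ → ℝ≥0 → E) (i : ℕ) (s : ℝ) :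
    ℝ :=
  (n : ℝ)⁻¹ * ζ (b i s.toNNReal)

section Particles

variable {E : Type*} {ζ : E → ℝ} {n : ℕ} {b : ℕ → ℝ≥0 → E} {x : ℕ → ℝ} {A : ℝ → ℝ}

theorem continuous_particleRate [TopologicalSpace E] (hζ : Continuous ζ)
    (hb : ∀ i, Continuous (b i)) (i : ℕ) : Continuous (particleRate ζ n b i) :=
  continuous_const.mul (hζ.comp ((hb i).comp continuous_real_toNNReal))

theorem particleRate_nonneg (hζ0 : ∀ y, 0 ≤ ζ y) (i : ℕ) (s : ℝ) : 0 ≤ particleRate ζ n b i s :=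
  mul_nonneg (by positivity) (hζ0 _)

theorem exists_isKillingClock [TopologicalSpace E] (hζ : Continuous ζ) (hζ0 : ∀ y, 0 ≤ ζ y)
    (n : ℕ) (hb : ∀ i, Continuous (b i)) (x : ℕ → ℝ) :
    ∃ A, IsKillingClock (Finset.range n) (particleRate ζ n b) x A := by
  obtain ⟨A, h1, h2, -, h4⟩ := exists_killingClock (x := x) (Finset.range n)
    (continuous_particleRate (n := n) hζ hb) (particleRate_nonneg hζ0) 0 0
  exact ⟨A, h1, h2, fun t ht => by simpa using h4 t ht⟩

theorem IsKillingClock.nonneg (hζ0 : ∀ y, 0 ≤ ζ y)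
    (hA : IsKillingClock (Finset.range n) (particleRate ζ n b) x A) {t : ℝ} (ht : 0 ≤ t) :
    0 ≤ A t := by
  rw [hA.eq t ht]
  exact intervalIntegral.integral_nonneg ht fun s _ =>
    killingRate_nonneg (particleRate_nonneg hζ0) _ _

variable [MeasurableSpace E] [MeasurableSingletonClass E] {T : ℝ≥0}

theorem totalRate_of_toMeasure_eq {m : Icc (0 : ℝ) T → SubProb E} (s : ℝ) (hs : s ∈ Icc (0 : ℝ) T)
    (h : ∀ t : Icc (0 : ℝ) T, (m t).toMeasure =
      aliveMeasure n (fun i => b i (t : ℝ).toNNReal) (fun i => A t < x i)) :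
    totalRate ζ m s = killingRate (Finset.range n) (particleRate ζ n b) x s (A s) := by
  refine (congrArg (fun t => ∫ y, ζ y ∂(m t).toMeasure) (projIcc_of_mem T.2 hs)).trans ?_
  exact (congrArg (fun μ => ∫ y, ζ y ∂μ) (h ⟨s, hs⟩)).trans (integral_aliveMeasure _ _ _ _)

/-- The accumulated rate of any solution solves the clock equation on `[0,T]`, so it is `A` by
uniqueness; the measures are then functions of the clock. No path regularity of `m` is assumed. -/
theorem SolvesKilling.toMeasure_eq {m : Icc (0 : ℝ) T → SubProb E} (hζ0 : ∀ y, 0 ≤ ζ y)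
    (hg : ∀ i, Continuous (particleRate ζ n b i))
    (hA : IsKillingClock (Finset.range n) (particleRate ζ n b) x A)
    (hm : SolvesKilling ζ n b x m) (t : Icc (0 : ℝ) T) :
    (m t).toMeasure = aliveMeasure n (fun i => b i (t : ℝ).toNNReal) (fun i => A t < x i) := by
  set A' : ℝ → ℝ := fun t => ∫ s in (0 : ℝ)..t, totalRate ζ m s with hA'
  have h1 : ∀ t : Icc (0 : ℝ) T, (m t).toMeasure =
      aliveMeasure n (fun i => b i (t : ℝ).toNNReal) (fun i => A' t < x i) := hm.eq
  have h2 : ∀ s ∈ Icc (0 : ℝ) T, totalRate ζ m s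
      = killingRate (Finset.range n) (particleRate ζ n b) x s (A' s) :=
    fun s hs => totalRate_of_toMeasure_eq s hs h1
  have hT : (0 : ℝ) ≤ T := T.2
  have h3 := killingClock_unique (T := T) (particleRate_nonneg hζ0)
    (intervalIntegrable_killingRate (S := Finset.range n) (x := x) hg
      (particleRate_nonneg hζ0) hA.continuous.measurable _ _)
    (hm.integrable.congr fun s hs => h2 s (by
      rw [uIoc_of_le hT] at hs; exact Ioc_subset_Icc_self hs))
    (fun t ht => hA.eq t ht.1)
    (fun t ht => by
      refine intervalIntegral.integral_congr fun s hs => ?_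
      rw [uIcc_of_le ht.1] at hs
      exact h2 s ⟨hs.1, hs.2.trans ht.2⟩) t t.2
  rw [h1, h3]

variable [TopologicalSpace E] [OpensMeasurableSpace E]

/-- The path of the particle system with killing clock `A`. -/
noncomputable def killedPath (T : ℝ≥0) (n : ℕ) {b : ℕ → ℝ≥0 → E} (hb : ∀ i, Continuous (b i))
    (x : ℕ → ℝ) {A : ℝ → ℝ} (hAc : Continuous A) (hAm : Monotone A) :
    SkorokhodSpace T (SubProb E) where
  toFun t := SubProb.ofMeasure
    (aliveMeasure n (fun i => b i (t : ℝ).toNNReal) (fun i => A t < x i))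
    (aliveMeasure_univ_le _ _ _)
  right_cont t := by
    refine SubProb.tendsto_iff.2 fun f => ?_
    simp only [SubProb.toMeasure_ofMeasure, integral_aliveMeasure]
    refine tendsto_finsetSum _ fun i _ => ?_
    have hcont : Continuous fun s : Icc (0 : ℝ) T => (n : ℝ)⁻¹ * f (b i (s : ℝ).toNNReal) :=
      continuous_const.mul (f.continuous.comp ((hb i).comp
        (continuous_real_toNNReal.comp continuous_subtype_val)))
    -- Being alive is an open condition because `A` is continuous; being dead is permanent because
    -- `A` is monotone.
    by_cases h : A t < x i
    · simp only [h, if_true]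
      refine (hcont.continuousWithinAt (s := Ici t)).tendsto.congr' ?_
      have : ∀ᶠ s : Icc (0 : ℝ) T in 𝓝 t, A s < x i :=
        (hAc.comp continuous_subtype_val).continuousAt.eventually_lt_const h
      filter_upwards [nhdsWithin_le_nhds this] with s hs
      simp [hs]
    · simp only [h, if_false]
      refine tendsto_const_nhds.congr' ?_
      filter_upwards [self_mem_nhdsWithin] with s hs
      rw [if_neg (not_lt.2 ((not_lt.1 h).trans (hAm hs)))]
  left_lim t := by
    classical
    -- The left limit counts the particles alive at all earlier times, including one whose threshold
    -- is reached exactly at `t`.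
    refine ⟨SubProb.ofMeasure (aliveMeasure n (fun i => b i (t : ℝ).toNNReal)
      (fun i => ∀ s : Icc (0 : ℝ) T, s < t → A s < x i)) (aliveMeasure_univ_le _ _ _), ?_⟩
    refine SubProb.tendsto_iff.2 fun f => ?_
    simp only [SubProb.toMeasure_ofMeasure, integral_aliveMeasure]
    refine tendsto_finsetSum _ fun i _ => ?_
    have hcont : Continuous fun s : Icc (0 : ℝ) T => (n : ℝ)⁻¹ * f (b i (s : ℝ).toNNReal) :=
      continuous_const.mul (f.continuous.comp ((hb i).comp
        (continuous_real_toNNReal.comp continuous_subtype_val)))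
    by_cases h : ∀ s : Icc (0 : ℝ) T, s < t → A s < x i
    · rw [if_pos h]
      refine (hcont.continuousWithinAt (s := Iio t)).tendsto.congr' ?_
      filter_upwards [self_mem_nhdsWithin] with s hs
      rw [if_pos (h s hs)]
    · rw [if_neg h]
      push Not at h
      obtain ⟨s₀, hs₀, hx⟩ := h
      refine tendsto_const_nhds.congr' ?_
      filter_upwards [nhdsWithin_le_nhds (Ioi_mem_nhds hs₀)] with s hs
      rw [if_neg (not_lt.2 (hx.trans (hAm (le_of_lt hs))))]

theorem solvesKilling_killedPath (hζ : Continuous ζ) (hζ0 : ∀ y, 0 ≤ ζ y)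
    (hb : ∀ i, Continuous (b i)) (hA : IsKillingClock (Finset.range n) (particleRate ζ n b) x A) :
    SolvesKilling ζ n b x (killedPath T n hb x hA.continuous hA.monotone).toFun := by
  set m := (killedPath T n hb x hA.continuous hA.monotone).toFun with hm
  have h1 : ∀ t : Icc (0 : ℝ) T, (m t).toMeasure =
      aliveMeasure n (fun i => b i (t : ℝ).toNNReal) (fun i => A t < x i) := fun t => rfl
  have h2 : ∀ s ∈ Icc (0 : ℝ) T, totalRate ζ m s
      = killingRate (Finset.range n) (particleRate ζ n b) x s (A s) :=
    fun s hs => totalRate_of_toMeasure_eq s hs h1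
  have hT : (0 : ℝ) ≤ T := T.2
  constructor
  · refine (intervalIntegrable_killingRate (S := Finset.range n) (x := x)
      (continuous_particleRate hζ hb) (particleRate_nonneg hζ0) hA.continuous.measurable 0
      (T : ℝ)).congr fun s hs => (h2 s ?_).symm
    rw [uIoc_of_le hT] at hs; exact Ioc_subset_Icc_self hs
  · intro t
    have : ∫ s in (0 : ℝ)..t, totalRate ζ m s = A t := by
      rw [hA.eq t t.2.1]
      refine intervalIntegral.integral_congr fun s hs => ?_
      rw [uIcc_of_le t.2.1] at hs
      exact h2 s ⟨hs.1, hs.2.trans t.2.2⟩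
    rw [this]
    exact h1 t

theorem existsUnique_solvesKilling (T : ℝ≥0) (n : ℕ) (hζ : Continuous ζ) (hζ0 : ∀ y, 0 ≤ ζ y)
    (hb : ∀ i, Continuous (b i)) (x : ℕ → ℝ) :
    ∃ m : SkorokhodSpace T (SubProb E), SolvesKilling ζ n b x m.toFun ∧
      ∀ m' : Icc (0 : ℝ) T → SubProb E, SolvesKilling ζ n b x m' → m' = m.toFun := by
  obtain ⟨A, hA⟩ := exists_isKillingClock hζ hζ0 n hb x
  refine ⟨_, solvesKilling_killedPath hζ hζ0 hb hA, fun m' hm' => funext fun t =>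
    SubProb.toMeasure_injective ?_⟩
  exact hm'.toMeasure_eq hζ0 (continuous_particleRate hζ hb) hA t

end Particles

/-! ### Marginals of Brownian motion -/

/-- The coordinates are independent centred Gaussians of variance `t`. Writing their joint law as a
dilated standard Gaussian includes `t = 0` and moves the time dependence into the integrand, ready
for dominated convergence. -/
theorem IsStdBrownian.map_eq {Ω : Type*} [MeasurableSpace Ω] {P : Measure Ω}
    [IsProbabilityMeasure P] {d : ℕ} {W : ℝ≥0 → Ω → EuclideanSpace ℝ (Fin d)}
    (hW : IsStdBrownian W P) (t : ℝ≥0) :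
    P.map (W t) = (stdGaussian (EuclideanSpace ℝ (Fin d))).map (fun z => √(t : ℝ) • z) := by
  have hlaw : ∀ j, HasLaw (fun ω => W t ω j) (gaussianReal 0 t) P := fun j =>
    (hW.coord j).hasLaw_eval t
  have hind : iIndepFun (fun (j : Fin d) ω => W t ω j) P :=
    hW.indep.comp (fun _ w => w t) fun _ => measurable_pi_apply t
  have hpi : P.map (fun ω j => W t ω j) = Measure.pi fun _ : Fin d => gaussianReal 0 t := by
    rw [(iIndepFun_iff_map_fun_eq_pi_map fun j => (hlaw j).aemeasurable).1 hind]
    exact congrArg Measure.pi (funext fun j => (hlaw j).map_eq)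
  have hscale : gaussianReal 0 t = (gaussianReal 0 1).map (√(t : ℝ) * ·) := by
    rw [gaussianReal_map_const_mul]
    congr 1
    · simp
    · ext; simp
  have hto : (W t) = (fun y : Fin d → ℝ => WithLp.toLp 2 y) ∘ fun ω j => W t ω j := by
    ext ω; rfl
  have hae : AEMeasurable (fun ω j => W t ω j) P :=
    aemeasurable_pi_lambda _ fun j => (hlaw j).aemeasurable
  have hm : Measurable fun y : Fin d → ℝ => (WithLp.toLp 2 y : EuclideanSpace ℝ (Fin d)) :=
    (PiLp.continuous_toLp 2 _).measurable
  have hmap : (Measure.pi fun _ : Fin d => (gaussianReal 0 1).map (√(t : ℝ) * ·)) =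
      (Measure.pi fun _ : Fin d => gaussianReal 0 1).map (fun y j => √(t : ℝ) * y j) := by
    have : ∀ _ : Fin d, SigmaFinite ((gaussianReal 0 1).map (√(t : ℝ) * ·)) := fun _ => by
      rw [← hscale]; infer_instance
    exact (Measure.pi_map_pi (fun _ => (measurable_const_mul _).aemeasurable)).symm
  rw [hto, ← AEMeasurable.map_map_of_aemeasurable hm.aemeasurable hae, hpi, hscale, hmap,
    Measure.map_map hm (by fun_prop), ← map_pi_eq_stdGaussian,
    Measure.map_map (by fun_prop) hm]
  rfl

/-- This holds for negative times too, since `Real.toNNReal` and the square root both vanish there.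
-/
theorem IsStdBrownian.marginalLaw_eq {Ω : Type*} [MeasurableSpace Ω] {P : Measure Ω}
    [IsProbabilityMeasure P] {d : ℕ} {W : ℝ≥0 → Ω → EuclideanSpace ℝ (Fin d)}
    (hW : IsStdBrownian W P) (t : ℝ) :
    marginalLaw P W t = (stdGaussian (EuclideanSpace ℝ (Fin d))).map (fun z => √t • z) := by
  rw [marginalLaw, hW.map_eq, Real.coe_toNNReal']
  congr 2
  rcases le_total 0 t with h | h
  · rw [max_eq_left h]
  · rw [max_eq_right h, Real.sqrt_eq_zero_of_nonpos h, Real.sqrt_zero]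

/-! ### Integrals against scaled Gaussians -/

section Gaussian

variable {E : Type*} [NormedAddCommGroup E]

/-- `F` grows at most quadratically. -/
def QuadraticGrowth (F : E → ℝ) (K : ℝ) : Prop := ∀ x, |F x| ≤ K * (1 + ‖x‖ ^ 2)

theorem QuadraticGrowth.nonneg {F : E → ℝ} {K : ℝ} (hF : QuadraticGrowth F K) : 0 ≤ K := by
  simpa using (abs_nonneg _).trans (hF 0)

theorem quadraticGrowth_of_rpow {F : E → ℝ} {p C : ℝ} (hp0 : 0 ≤ p) (hp2 : p < 2) (hC : 0 < C)
    (h : ∀ x, 0 ≤ F x ∧ F x ≤ C * (1 + ‖x‖ ^ p)) : QuadraticGrowth F (2 * C) := by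
  intro x
  rw [abs_of_nonneg (h x).1]
  have h1 : ‖x‖ ^ p ≤ 1 + ‖x‖ ^ 2 := by
    rcases le_total ‖x‖ 1 with hx | hx
    · have := Real.rpow_le_one (norm_nonneg x) hx hp0
      nlinarith [sq_nonneg ‖x‖]
    · have := Real.rpow_le_rpow_of_exponent_le hx hp2.le
      rw [Real.rpow_two] at this
      linarith
  have := (h x).2
  nlinarith [sq_nonneg ‖x‖]

theorem quadraticGrowth_of_bounded (f : BoundedContinuousFunction E ℝ) :
    QuadraticGrowth f ‖f‖ := by
  intro x
  have := f.norm_coe_le_norm x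
  rw [Real.norm_eq_abs] at this
  nlinarith [norm_nonneg f, sq_nonneg ‖x‖, mul_nonneg (norm_nonneg f) (sq_nonneg ‖x‖)]

variable [InnerProductSpace ℝ E]

/-- One dominating function for all `t ≤ R`, integrable and square integrable under the Gaussian. -/
theorem QuadraticGrowth.scaled_le {F : E → ℝ} {K : ℝ} (hF : QuadraticGrowth F K) {t R : ℝ}
    (hR : 0 ≤ R) (ht : t ≤ R) (z : E) : |F (√t • z)| ≤ K * (1 + R * ‖z‖ ^ 2) := by
  refine (hF _).trans (mul_le_mul_of_nonneg_left ?_ hF.nonneg)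
  rw [norm_smul, mul_pow, Real.norm_eq_abs, sq_abs]
  have : √t ^ 2 ≤ R := by
    rcases le_total 0 t with h | h
    · rwa [Real.sq_sqrt h]
    · rw [Real.sqrt_eq_zero_of_nonpos h]; simpa using hR
  gcongr

/-- The heat kernel `(2πt)^{-d/2} exp(-‖x‖²/(2t))`. -/
noncomputable def heatKernel (E : Type*) [NormedAddCommGroup E] [InnerProductSpace ℝ E] (t : ℝ)
    (x : E) : ℝ :=
  Real.exp (-(Module.finrank ℝ E / 2 * Real.log (2 * Real.pi * t))) * Real.exp (-‖x‖ ^ 2 / (2 * t))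

theorem heatKernel_nonneg (t : ℝ) (x : E) : 0 ≤ heatKernel E t x := by
  unfold heatKernel; positivity

theorem continuous_heatKernel (t : ℝ) : Continuous (heatKernel E t) := by
  unfold heatKernel; fun_prop

variable [FiniteDimensional ℝ E] [MeasurableSpace E] [BorelSpace E]

theorem integrable_norm_pow_stdGaussian (k : ℕ) :
    Integrable (fun z : E => ‖z‖ ^ k) (stdGaussian E) := by
  rcases eq_or_ne k 0 with rfl | hk
  · simp
  · exact (IsGaussian.memLp_id (stdGaussian E) k (by simp)).integrable_norm_pow hk

theorem integrable_quadratic_bound (K R : ℝ) :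
    Integrable (fun z : E => K * (1 + R * ‖z‖ ^ 2)) (stdGaussian E) :=
  ((integrable_const _).add ((integrable_norm_pow_stdGaussian 2).const_mul R)).const_mul K

theorem QuadraticGrowth.integrable_scaled {F : E → ℝ} {K : ℝ} (hF : QuadraticGrowth F K)
    (hFc : Continuous F) (t : ℝ) : Integrable (fun z => F (√t • z)) (stdGaussian E) := by
  refine (integrable_quadratic_bound K |t|).mono'
    (hFc.comp (continuous_const_smul _)).aestronglyMeasurable (ae_of_all _ fun z => ?_)
  exact hF.scaled_le (abs_nonneg t) (le_abs_self t) z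

theorem QuadraticGrowth.continuous_integral_scaled {F : E → ℝ} {K : ℝ}
    (hF : QuadraticGrowth F K) (hFc : Continuous F) :
    Continuous fun t : ℝ => ∫ z, F (√t • z) ∂(stdGaussian E) := by
  refine continuous_iff_continuousAt.2 fun t₀ => ?_
  refine continuousAt_of_dominated (bound := fun z => K * (1 + (|t₀| + 1) * ‖z‖ ^ 2))
    (Eventually.of_forall fun t => (hFc.comp (continuous_const_smul _)).aestronglyMeasurable) ?_
    (integrable_quadratic_bound _ _) (ae_of_all _ fun z => ?_)
  · filter_upwards [Iio_mem_nhds (show t₀ < |t₀| + 1 by linarith [le_abs_self t₀])] with t ht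
    exact ae_of_all _ fun z => hF.scaled_le (by positivity) (le_of_lt ht) z
  · exact (hFc.comp (Real.continuous_sqrt.smul continuous_const)).continuousAt

/-- Fourth Gaussian moments give a second-moment bound uniform in time, which becomes the variance
bound in the law of large numbers. -/
theorem QuadraticGrowth.integrable_sq_scaled {F : E → ℝ} {K : ℝ} (hF : QuadraticGrowth F K)
    (hFc : Continuous F) (t : ℝ) :
    Integrable (fun z => F (√t • z) ^ 2) (stdGaussian E) ∧
      ∀ R, 0 ≤ R → t ≤ R → ∫ z, F (√t • z) ^ 2 ∂(stdGaussian E) ≤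
        ∫ z : E, (K * (1 + R * ‖z‖ ^ 2)) ^ 2 ∂(stdGaussian E) := by
  have hint : ∀ R : ℝ, Integrable (fun z : E => (K * (1 + R * ‖z‖ ^ 2)) ^ 2) (stdGaussian E) := by
    intro R
    have : (fun z : E => (K * (1 + R * ‖z‖ ^ 2)) ^ 2) =
        fun z => K ^ 2 + 2 * K ^ 2 * R * ‖z‖ ^ 2 + K ^ 2 * R ^ 2 * ‖z‖ ^ 4 := by
      ext z; ring
    rw [this]
    exact ((integrable_const _).add ((integrable_norm_pow_stdGaussian 2).const_mul _)).add
      ((integrable_norm_pow_stdGaussian 4).const_mul _)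
  have hle : ∀ R, 0 ≤ R → t ≤ R → ∀ z : E, F (√t • z) ^ 2 ≤ (K * (1 + R * ‖z‖ ^ 2)) ^ 2 :=
    fun R hR ht z => by
      rw [← sq_abs (F _)]
      exact pow_le_pow_left₀ (abs_nonneg _) (hF.scaled_le hR ht z) 2
  have hi : Integrable (fun z => F (√t • z) ^ 2) (stdGaussian E) := by
    refine (hint |t|).mono'
      ((hFc.comp (continuous_const_smul _)).pow 2).aestronglyMeasurable (ae_of_all _ fun z => ?_)
    rw [Real.norm_of_nonneg (sq_nonneg _)]
    exact hle _ (abs_nonneg _) (le_abs_self _) z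
  exact ⟨hi, fun R hR ht => integral_mono hi (hint R) (hle R hR ht)⟩

/-! ### The heat kernel -/

theorem integrable_heatKernel {t : ℝ} (ht : 0 < t) : Integrable (heatKernel E t) := by
  refine Integrable.const_mul ?_ _
  have h := (GaussianFourier.integrable_cexp_neg_mul_sq_norm_add (V := E) (b := ((1 / (2 * t) : ℝ) : ℂ))
    (by rw [Complex.ofReal_re]; positivity) 0 0).re
  refine h.congr (ae_of_all _ fun x => ?_)
  have : -((1 / (2 * t) : ℝ) : ℂ) * (‖x‖ : ℂ) ^ 2 + 0 * ((inner ℝ (0 : E) x : ℝ) : ℂ)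
      = ((-‖x‖ ^ 2 / (2 * t) : ℝ) : ℂ) := by push_cast; ring
  simp only [this, ← Complex.ofReal_exp]
  exact Complex.ofReal_re _

theorem charFun_heatKernel {t : ℝ} (ht : 0 < t) (ξ : E) :
    charFun (volume.withDensity fun x => ENNReal.ofReal (heatKernel E t x)) ξ
      = Complex.exp (-(t * ‖ξ‖ ^ 2) / 2) := by
  rw [charFun_apply, integral_withDensity_eq_integral_toReal_smul
    (continuous_heatKernel t).measurable.ennreal_ofReal (by simp)]
  simp only [ENNReal.toReal_ofReal (heatKernel_nonneg t _)]
  have h := GaussianFourier.integral_cexp_neg_mul_sq_norm_add (V := E) (b := ((1 / (2 * t) : ℝ) : ℂ))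
    (by rw [Complex.ofReal_re]; positivity) Complex.I ξ
  have e : ∀ x : E, heatKernel E t x • Complex.exp ((inner ℝ x ξ : ℝ) * Complex.I)
      = (Real.exp (-(Module.finrank ℝ E / 2 * Real.log (2 * Real.pi * t))) : ℂ) *
        Complex.exp (-((1 / (2 * t) : ℝ) : ℂ) * ‖x‖ ^ 2 + Complex.I * (inner ℝ ξ x : ℝ)) := by
    intro x
    rw [heatKernel, Complex.real_smul, Complex.ofReal_mul, mul_assoc, Complex.exp_add]
    congr 2
    · rw [Complex.ofReal_exp]; congr 1; push_cast; ring
    · rw [real_inner_comm]; ring_nf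
  simp only [e]
  rw [integral_const_mul, h, ← mul_assoc]
  have hpos : 0 < 2 * Real.pi * t := by positivity
  have hbase : ((Real.pi : ℂ) / ((1 / (2 * t) : ℝ) : ℂ)) ^ (Module.finrank ℝ E / 2 : ℂ)
      = (Real.exp (Module.finrank ℝ E / 2 * Real.log (2 * Real.pi * t)) : ℂ) := by
    have h1 : (Real.pi : ℂ) / ((1 / (2 * t) : ℝ) : ℂ) = ((2 * Real.pi * t : ℝ) : ℂ) := by
      rw [← Complex.ofReal_div]; congr 1; field_simp
    have h2 : (Module.finrank ℝ E / 2 : ℂ) = ((Module.finrank ℝ E / 2 : ℝ) : ℂ) := by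
      push_cast; rfl
    rw [h1, h2, ← Complex.ofReal_cpow hpos.le, Real.rpow_def_of_pos hpos, mul_comm]
  rw [hbase, ← Complex.ofReal_mul, ← Real.exp_add, neg_add_cancel, Real.exp_zero,
    Complex.ofReal_one, one_mul, Complex.I_sq]
  congr 1
  have : (t : ℂ) ≠ 0 := by exact_mod_cast ht.ne'
  push_cast
  field_simp
  norm_num

/-- Both are finite measures with characteristic function `exp(-t‖ξ‖²/2)`; the normalisation of the
kernel comes out of the same computation, at `ξ = 0`. -/
theorem map_smul_stdGaussian {t : ℝ} (ht : 0 < t) :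
    (stdGaussian E).map (fun z => √t • z)
      = volume.withDensity fun x => ENNReal.ofReal (heatKernel E t x) := by
  have : IsFiniteMeasure (volume.withDensity fun x => ENNReal.ofReal (heatKernel E t x)) :=
    isFiniteMeasure_withDensity_ofReal (integrable_heatKernel ht).2
  have : IsProbabilityMeasure ((stdGaussian E).map (fun z => √t • z)) :=
    Measure.isProbabilityMeasure_map (by fun_prop)
  refine Measure.ext_of_charFun (funext fun ξ => ?_)
  rw [charFun_heatKernel ht, charFun_map_smul, charFun_stdGaussian, norm_smul, Real.norm_eq_abs]
  congr 1
  push_cast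
  rw [mul_pow, ← Complex.ofReal_pow, sq_abs, Real.sq_sqrt ht.le]

theorem integral_mul_heatKernel {t : ℝ} (ht : 0 < t) (F : E → ℝ) (hF : Continuous F) :
    ∫ x, F x * heatKernel E t x = ∫ z, F (√t • z) ∂(stdGaussian E) := by
  have h := integral_map (μ := stdGaussian E) (φ := fun z => √t • z) (f := F)
    (by fun_prop) hF.aestronglyMeasurable
  rw [← h, map_smul_stdGaussian ht, integral_withDensity_eq_integral_toReal_smul
    (continuous_heatKernel t).measurable.ennreal_ofReal (by simp)]
  simp only [ENNReal.toReal_ofReal (heatKernel_nonneg t _), smul_eq_mul, mul_comm]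

theorem integrable_mul_heatKernel {t : ℝ} (ht : 0 < t) (F : E → ℝ) (hF : Continuous F)
    (hi : Integrable (fun z => F (√t • z)) (stdGaussian E)) :
    Integrable fun x => F x * heatKernel E t x := by
  have h := (integrable_map_measure (μ := stdGaussian E) (f := fun z => √t • z) (g := F)
    hF.aestronglyMeasurable (by fun_prop)).2 hi
  rw [map_smul_stdGaussian ht, integrable_withDensity_iff
    (continuous_heatKernel t).measurable.ennreal_ofReal (by simp)] at h
  simpa only [ENNReal.toReal_ofReal (heatKernel_nonneg t _)] using h

end Gaussian

/-! ### The reaction-diffusion equation -/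

section GaussianProfile

variable {E : Type*} [NormedAddCommGroup E] [InnerProductSpace ℝ E]

/-- The profile `exp(-‖x‖²/2)` of the heat kernel. -/
noncomputable def gaussianProfile (E : Type*) [NormedAddCommGroup E] (x : E) : ℝ :=
  Real.exp (-(‖x‖ ^ 2 / 2))

theorem contDiff_gaussianProfile : ContDiff ℝ 2 (gaussianProfile E) :=
  (((contDiff_norm_sq ℝ).div_const 2).neg).exp

theorem heatKernel_eq_gaussianProfile {t : ℝ} (ht : 0 < t) (x : E) :
    heatKernel E t x = Real.exp (-(Module.finrank ℝ E / 2 * Real.log (2 * Real.pi * t))) *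
      gaussianProfile E ((√t)⁻¹ • x) := by
  rw [heatKernel, gaussianProfile, norm_smul, mul_pow, norm_inv, inv_pow, Real.norm_eq_abs, sq_abs,
    Real.sq_sqrt ht.le]
  congr 2
  field_simp

theorem hasFDerivAt_gaussianProfile (x : E) :
    HasFDerivAt (gaussianProfile E) (-(gaussianProfile E x • innerSL ℝ x)) x := by
  have h := (((hasStrictFDerivAt_norm_sq x).hasFDerivAt.mul_const (1 / 2)).neg).exp
  have e : gaussianProfile E = fun y : E => Real.exp (-(‖y‖ ^ 2 * (1 / 2))) := by
    ext y; rw [gaussianProfile]; ring_nf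
  rw [e]
  refine h.congr_fderiv ?_
  ext v
  simp

theorem iteratedFDeriv_two_gaussianProfile (x v : E) :
    iteratedFDeriv ℝ 2 (gaussianProfile E) x ![v, v]
      = gaussianProfile E x * (inner ℝ x v ^ 2 - ‖v‖ ^ 2) := by
  have h1 : fderiv ℝ (gaussianProfile E)
      = fun y : E => -(gaussianProfile E y • innerSL ℝ y) :=
    funext fun y => (hasFDerivAt_gaussianProfile y).fderiv
  have h2 : HasFDerivAt (fun y : E => -(gaussianProfile E y • innerSL ℝ y)) _ x :=
    ((hasFDerivAt_gaussianProfile x).smul (innerSL ℝ (E := E)).hasFDerivAt).neg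
  rw [iteratedFDeriv_two_apply, h1, h2.fderiv]
  change -(gaussianProfile E x * inner ℝ v v + -(gaussianProfile E x * inner ℝ x v) * inner ℝ x v)
    = _
  rw [real_inner_self_eq_norm_sq]
  ring

open scoped Laplacian in
-- Summing the second derivatives over an orthonormal basis, Parseval gives `‖x‖²` and the unit
-- vectors give the dimension.
theorem laplacian_gaussianProfile [FiniteDimensional ℝ E] (x : E) :
    Δ (gaussianProfile E) x = gaussianProfile E x * (‖x‖ ^ 2 - Module.finrank ℝ E) := by
  rw [InnerProductSpace.laplacian_eq_iteratedFDeriv_stdOrthonormalBasis]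
  simp only [iteratedFDeriv_two_gaussianProfile]
  rw [← Finset.mul_sum, Finset.sum_sub_distrib]
  congr 2
  · exact (stdOrthonormalBasis ℝ E).sum_sq_inner_left x
  · simp

/-- Scaling reduces every spatial derivative to one of a fixed profile, so joint continuity in `(t,
x)` follows from continuity of the scaling factors. -/
theorem iteratedFDeriv_mul_heatKernel (a : ℝ) {t : ℝ} (ht : 0 < t) {k : ℕ} (hk : k ≤ 2) (x : E) :
    iteratedFDeriv ℝ k (fun y => a * heatKernel E t y) x =
      (a * Real.exp (-(Module.finrank ℝ E / 2 * Real.log (2 * Real.pi * t))) * (√t)⁻¹ ^ k) •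
        iteratedFDeriv ℝ k (gaussianProfile E) ((√t)⁻¹ • x) := by
  have hc : ContDiff ℝ k (gaussianProfile E) :=
    contDiff_gaussianProfile.of_le (by exact_mod_cast hk)
  have e : (fun y => a * heatKernel E t y) =
      (a * Real.exp (-(Module.finrank ℝ E / 2 * Real.log (2 * Real.pi * t)))) •
        fun y : E => gaussianProfile E ((√t)⁻¹ • y) := by
    ext y
    rw [heatKernel_eq_gaussianProfile ht, Pi.smul_apply, smul_eq_mul, ← mul_assoc]
  have hc' : ContDiff ℝ k fun y : E => gaussianProfile E ((√t)⁻¹ • y) :=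
    hc.comp (contDiff_const_smul (√t)⁻¹)
  rw [e, iteratedFDeriv_const_smul_apply hc'.contDiffAt, iteratedFDeriv_comp_const_smul _ hc,
    smul_smul]

open scoped Laplacian in
theorem laplacian_mul_heatKernel [FiniteDimensional ℝ E] (a : ℝ) {t : ℝ} (ht : 0 < t) (x : E) :
    Δ (fun y => a * heatKernel E t y) x =
      a * heatKernel E t x * (‖x‖ ^ 2 / t ^ 2 - Module.finrank ℝ E / t) := by
  have h := laplacian_gaussianProfile ((√t)⁻¹ • x)
  rw [InnerProductSpace.laplacian_eq_iteratedFDeriv_stdOrthonormalBasis] at h ⊢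
  dsimp only at h
  simp only [iteratedFDeriv_mul_heatKernel a ht le_rfl, smul_apply, smul_eq_mul]
  rw [← Finset.mul_sum, h, heatKernel_eq_gaussianProfile ht, norm_smul, mul_pow, norm_inv, inv_pow,
    inv_pow, Real.norm_eq_abs, sq_abs, Real.sq_sqrt ht.le]
  field_simp

/-- The derivative is half the Laplacian found in `laplacian_mul_heatKernel`: this is the heat
equation. -/
theorem hasDerivAt_heatKernel {t : ℝ} (ht : 0 < t) (x : E) :
    HasDerivAt (fun s => heatKernel E s x)
      (heatKernel E t x * (1 / 2 * (‖x‖ ^ 2 / t ^ 2 - Module.finrank ℝ E / t))) t := by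
  have h1 : HasDerivAt (fun s : ℝ => Real.log (2 * Real.pi * s)) (1 / t) t := by
    refine (((hasDerivAt_id t).const_mul (2 * Real.pi)).log (by simp; positivity)).congr_deriv ?_
    simp only [id]
    field_simp
  have h2 : HasDerivAt (fun s : ℝ => -‖x‖ ^ 2 / (2 * s)) (‖x‖ ^ 2 / (2 * t ^ 2)) t := by
    refine ((hasDerivAt_const t (-‖x‖ ^ 2)).div ((hasDerivAt_id t).const_mul 2)
      (by simp; positivity)).congr_deriv ?_
    simp only [id]
    field_simp
    ring
  refine (((h1.const_mul _).neg.exp).mul h2.exp).congr_deriv ?_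
  simp only [heatKernel, Pi.neg_apply]
  ring

end GaussianProfile

section Limit

variable {E : Type*} [NormedAddCommGroup E] [InnerProductSpace ℝ E] [FiniteDimensional ℝ E]
  [MeasurableSpace E]

/-- The rate `⟨ζ, Law(W(t))⟩`, for a standard Brownian motion `W`. -/
noncomputable def gaussianRate (ζ : E → ℝ) (t : ℝ) : ℝ := ∫ z, ζ (√t • z) ∂(stdGaussian E)

/-- The survival probability `1 / (1 + ∫_0^t ⟨ζ, Law(W(s))⟩ ds)`. -/
noncomputable def gaussianSurvival (ζ : E → ℝ) (t : ℝ) : ℝ :=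
  1 / (1 + ∫ s in (0 : ℝ)..t, gaussianRate ζ s)

variable {ζ : E → ℝ} {K : ℝ}

theorem gaussianRate_nonneg (hζ0 : ∀ y, 0 ≤ ζ y) (t : ℝ) : 0 ≤ gaussianRate ζ t :=
  integral_nonneg fun _ => hζ0 _

theorem one_le_gaussianSurvival_denom (hζ0 : ∀ y, 0 ≤ ζ y) {t : ℝ} (ht : 0 ≤ t) :
    1 ≤ 1 + ∫ s in (0 : ℝ)..t, gaussianRate ζ s :=
  le_add_of_nonneg_right
    (intervalIntegral.integral_nonneg ht fun s _ => gaussianRate_nonneg hζ0 s)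

theorem gaussianSurvival_pos (hζ0 : ∀ y, 0 ≤ ζ y) {t : ℝ} (ht : 0 ≤ t) :
    0 < gaussianSurvival ζ t :=
  one_div_pos.2 (zero_lt_one.trans_le (one_le_gaussianSurvival_denom hζ0 ht))

theorem gaussianSurvival_le_one (hζ0 : ∀ y, 0 ≤ ζ y) {t : ℝ} (ht : 0 ≤ t) :
    gaussianSurvival ζ t ≤ 1 := by
  have := one_le_gaussianSurvival_denom hζ0 ht
  rw [gaussianSurvival, div_le_one (by linarith)]
  exact this

variable [BorelSpace E]

theorem continuous_gaussianRate (hζ : Continuous ζ) (hK : QuadraticGrowth ζ K) :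
    Continuous (gaussianRate ζ) := hK.continuous_integral_scaled hζ

/-- The rate is continuous on all of `ℝ`, being constant for negative times, so the derivative is
two-sided even at `t = 0`. -/
theorem hasDerivAt_gaussianSurvival (hζ : Continuous ζ) (hζ0 : ∀ y, 0 ≤ ζ y)
    (hK : QuadraticGrowth ζ K) {t : ℝ} (ht : 0 ≤ t) :
    HasDerivAt (gaussianSurvival ζ) (-(gaussianRate ζ t * gaussianSurvival ζ t ^ 2)) t := by
  have hb := continuous_gaussianRate hζ hK
  have h1 : HasDerivAt (fun t => 1 + ∫ s in (0 : ℝ)..t, gaussianRate ζ s) (gaussianRate ζ t) t :=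
    (intervalIntegral.integral_hasDerivAt_right (hb.intervalIntegrable _ _)
      (hb.stronglyMeasurableAtFilter _ _) hb.continuousAt).const_add 1
  have hne : 1 + ∫ s in (0 : ℝ)..t, gaussianRate ζ s ≠ 0 := by
    have := one_le_gaussianSurvival_denom hζ0 ht
    positivity
  have h2 := h1.inv hne
  have e : gaussianSurvival ζ = (fun t => 1 + ∫ s in (0 : ℝ)..t, gaussianRate ζ s)⁻¹ := by
    ext s; simp [gaussianSurvival]
  rw [e]
  refine h2.congr_deriv ?_
  simp only [Pi.inv_apply]
  field_simp

theorem continuousOn_gaussianSurvival (hζ : Continuous ζ) (hζ0 : ∀ y, 0 ≤ ζ y)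
    (hK : QuadraticGrowth ζ K) : ContinuousOn (gaussianSurvival ζ) (Ici 0) := fun _ ht =>
  (hasDerivAt_gaussianSurvival hζ hζ0 hK ht).continuousAt.continuousWithinAt

/-- Product rule: the kernel contributes `½Δu`, and the factor contributes `-b a²` times the kernel,
which is `-⟨ζ, u⟩ u` because `⟨ζ, u⟩ = a b`. -/
theorem solvesReactionDiffusion_heatKernel (hζ : Continuous ζ) (hζ0 : ∀ y, 0 ≤ ζ y)
    (hK : QuadraticGrowth ζ K) :
    SolvesReactionDiffusion ζ fun t x => gaussianSurvival ζ t * heatKernel E t x := by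
  have hac : ContinuousOn (fun q : ℝ × E => gaussianSurvival ζ q.1) (Ioi 0 ×ˢ univ) :=
    ((continuousOn_gaussianSurvival hζ hζ0 hK).mono Ioi_subset_Ici_self).comp
      continuousOn_fst fun q hq => hq.1
  have hlog : ContinuousOn (fun q : ℝ × E => Real.exp (-(Module.finrank ℝ E / 2 *
      Real.log (2 * Real.pi * q.1)))) (Ioi 0 ×ˢ univ) := by
    refine Real.continuous_exp.comp_continuousOn (ContinuousOn.neg (continuousOn_const.mul ?_))
    refine ContinuousOn.log (by fun_prop) fun q hq => ?_
    have : 0 < q.1 := hq.1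
    positivity
  have hsq : ContinuousOn (fun q : ℝ × E => (√q.1)⁻¹) (Ioi 0 ×ˢ univ) := by
    refine ContinuousOn.inv₀ (by fun_prop) fun q hq => ?_
    have : 0 < q.1 := hq.1
    positivity
  have hrate : ∀ t, 0 < t → ∫ y, ζ y * (gaussianSurvival ζ t * heatKernel E t y) =
      gaussianSurvival ζ t * gaussianRate ζ t := by
    intro t ht
    rw [gaussianRate, ← integral_mul_heatKernel ht ζ hζ, ← integral_const_mul]
    congr 1 with y
    ring
  have hpde : ∀ t, 0 < t → ∀ x : E, HasDerivAt
      (fun s => gaussianSurvival ζ s * heatKernel E s x)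
      (gaussianSurvival ζ t * heatKernel E t x *
        (1 / 2 * (‖x‖ ^ 2 / t ^ 2 - Module.finrank ℝ E / t) -
          gaussianSurvival ζ t * gaussianRate ζ t)) t := by
    intro t ht x
    refine ((hasDerivAt_gaussianSurvival hζ hζ0 hK ht.le).mul
      (hasDerivAt_heatKernel ht x)).congr_deriv ?_
    ring
  have hker : ContinuousOn (fun q : ℝ × E => heatKernel E q.1 q.2) (Ioi 0 ×ˢ univ) := by
    refine hlog.mul (Real.continuous_exp.comp_continuousOn (ContinuousOn.div (by fun_prop)
      (by fun_prop) fun q hq => ?_))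
    have : 0 < q.1 := hq.1
    positivity
  constructor
  · intro t ht x
    exact mul_nonneg (gaussianSurvival_pos hζ0 ht.le).le (heatKernel_nonneg t x)
  · intro t ht
    have e : (fun x => gaussianSurvival ζ t * heatKernel E t x) = fun x => gaussianSurvival ζ t *
        (Real.exp (-(Module.finrank ℝ E / 2 * Real.log (2 * Real.pi * t))) *
          gaussianProfile E ((√t)⁻¹ • x)) := by
      ext x; rw [heatKernel_eq_gaussianProfile ht]
    rw [e]
    exact contDiff_const.mul (contDiff_const.mul
      (contDiff_gaussianProfile.comp (contDiff_const_smul _)))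
  · intro k hk
    have hc : Continuous (iteratedFDeriv ℝ k (gaussianProfile E)) :=
      contDiff_gaussianProfile.continuous_iteratedFDeriv (by exact_mod_cast hk)
    have h : ContinuousOn (fun q : ℝ × E => (gaussianSurvival ζ q.1 *
        Real.exp (-(Module.finrank ℝ E / 2 * Real.log (2 * Real.pi * q.1))) * (√q.1)⁻¹ ^ k) •
        iteratedFDeriv ℝ k (gaussianProfile E) ((√q.1)⁻¹ • q.2)) (Ioi 0 ×ˢ univ) :=
      ((hac.mul hlog).mul (hsq.pow k)).smul
        (hc.comp_continuousOn (hsq.smul continuousOn_snd))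
    exact h.congr fun q hq => iteratedFDeriv_mul_heatKernel _ hq.1 hk q.2
  · have h : ContinuousOn (fun q : ℝ × E => gaussianSurvival ζ q.1 * heatKernel E q.1 q.2 *
        (1 / 2 * (‖q.2‖ ^ 2 / q.1 ^ 2 - Module.finrank ℝ E / q.1) -
          gaussianSurvival ζ q.1 * gaussianRate ζ q.1)) (Ioi 0 ×ˢ univ) := by
      have hb : ContinuousOn (fun q : ℝ × E => gaussianRate ζ q.1) (Ioi 0 ×ˢ univ) :=
        ((continuous_gaussianRate hζ hK).comp continuous_fst).continuousOn
      have h1 : ContinuousOn (fun q : ℝ × E => ‖q.2‖ ^ 2 / q.1 ^ 2 - Module.finrank ℝ E / q.1)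
          (Ioi 0 ×ˢ univ) := by
        refine ContinuousOn.sub (ContinuousOn.div (by fun_prop) (by fun_prop) fun q hq => ?_)
          (ContinuousOn.div (by fun_prop) (by fun_prop) fun q hq => ?_)
        · have : 0 < q.1 := hq.1
          positivity
        · have : 0 < q.1 := hq.1
          positivity
      exact (hac.mul hker).mul ((continuousOn_const.mul h1).sub (hac.mul hb))
    exact h.congr fun q hq => (hpde q.1 hq.1 q.2).deriv
  · intro t ht
    exact (integrable_heatKernel ht).const_mul _
  · intro t ht
    refine ((integrable_mul_heatKernel ht ζ hζ (hK.integrable_scaled hζ t)).const_mul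
      (gaussianSurvival ζ t)).congr (ae_of_all _ fun y => ?_)
    ring
  · intro t ht x
    refine (hpde t ht x).congr_deriv ?_
    rw [laplacian_mul_heatKernel _ ht, hrate t ht]
    ring
  · intro f
    -- As a Gaussian integral of `f(√t z)`, the integral against the kernel extends continuously to
    -- `t = 0` with value `f 0`.
    have hf := (quadraticGrowth_of_bounded f).continuous_integral_scaled f.continuous
    have h1 : Tendsto (fun t => gaussianSurvival ζ t * ∫ z, f (√t • z) ∂(stdGaussian E))
        (𝓝[>] 0) (𝓝 (f 0)) := by
      have ha : Tendsto (gaussianSurvival ζ) (𝓝[>] 0) (𝓝 1) := by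
        have := (hasDerivAt_gaussianSurvival hζ hζ0 hK le_rfl).continuousAt.tendsto
        have e : gaussianSurvival ζ 0 = 1 := by simp [gaussianSurvival]
        rw [e] at this
        exact this.mono_left nhdsWithin_le_nhds
      have hb := (hf.tendsto 0).mono_left (nhdsWithin_le_nhds (s := Ioi 0))
      simpa using ha.mul hb
    refine h1.congr' ?_
    filter_upwards [self_mem_nhdsWithin] with t ht
    rw [← integral_mul_heatKernel ht f f.continuous, ← integral_const_mul]
    congr 1 with y
    ring

end Limit

/-! ### Independence of pairs -/

theorem map_prod_prod_swap {α β γ δ : Type*} [MeasurableSpace α] [MeasurableSpace β]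
    [MeasurableSpace γ] [MeasurableSpace δ] (μ : Measure α) (ν : Measure β) (ρ : Measure γ)
    (τ : Measure δ) [IsProbabilityMeasure μ] [IsProbabilityMeasure ν] [IsProbabilityMeasure ρ]
    [IsProbabilityMeasure τ] :
    ((μ.prod ν).prod (ρ.prod τ)).map (fun q => ((q.1.1, q.2.1), (q.1.2, q.2.2)))
      = (μ.prod ρ).prod (ν.prod τ) := by
  refine Measure.ext_of_lintegral _ fun f hf => ?_
  rw [lintegral_map hf (by fun_prop), lintegral_prod _ (by fun_prop), lintegral_prod _ (by fun_prop),
    lintegral_prod _ hf.aemeasurable,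
    lintegral_prod _ (Measurable.aemeasurable (Measurable.lintegral_prod_right' hf))]
  refine lintegral_congr fun a => ?_
  have h1 : ∀ b, ∫⁻ q : γ × δ, f ((a, q.1), (b, q.2)) ∂(ρ.prod τ)
      = ∫⁻ c, ∫⁻ e, f ((a, c), (b, e)) ∂τ ∂ρ := fun b =>
    lintegral_prod _ (by fun_prop)
  have h2 : ∀ c, ∫⁻ q : β × δ, f ((a, c), q) ∂(ν.prod τ)
      = ∫⁻ b, ∫⁻ e, f ((a, c), (b, e)) ∂τ ∂ν := fun c =>
    lintegral_prod _ (by fun_prop)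
  simp only [h1, h2]
  refine lintegral_lintegral_swap (Measurable.aemeasurable ?_)
  have : Measurable fun q : (β × γ) × δ => f ((a, q.1.2), (q.1.1, q.2)) := by fun_prop
  exact this.lintegral_prod_right'

/-- The hypotheses make the joint law of the four variables a product, which may be regrouped. It
turns independence of paths, of thresholds, and between the two families into independence of
particles. -/
theorem ProbabilityTheory.IndepFun.prodMk_prodMk {Ω α β : Type*} [MeasurableSpace Ω]
    [MeasurableSpace α] [MeasurableSpace β] {P : Measure Ω} [IsProbabilityMeasure P]
    {U V : Ω → α} {X Y : Ω → β} (hU : Measurable U) (hV : Measurable V) (hX : Measurable X)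
    (hY : Measurable Y) (hUV : IndepFun U V P) (hXY : IndepFun X Y P)
    (h : IndepFun (fun ω => (U ω, V ω)) (fun ω => (X ω, Y ω)) P) :
    IndepFun (fun ω => (U ω, X ω)) (fun ω => (V ω, Y ω)) P := by
  have iU := Measure.isProbabilityMeasure_map (μ := P) hU.aemeasurable
  have iV := Measure.isProbabilityMeasure_map (μ := P) hV.aemeasurable
  have iX := Measure.isProbabilityMeasure_map (μ := P) hX.aemeasurable
  have iY := Measure.isProbabilityMeasure_map (μ := P) hY.aemeasurable
  have hUX : IndepFun U X P := h.comp measurable_fst measurable_fst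
  have hVY : IndepFun V Y P := h.comp measurable_snd measurable_snd
  rw [indepFun_iff_map_prod_eq_prod_map_map (by fun_prop) (by fun_prop)] at h hUV hXY hUX hVY ⊢
  rw [hUX, hVY, ← map_prod_prod_swap, ← hUV, ← hXY, ← h,
    Measure.map_map (by fun_prop) (by fun_prop)]
  rfl

/-! ### The law of the paths -/

/-- Finite-dimensional laws fix the law of each coordinate path, and independence of the coordinates
fixes the joint law. Equality of path laws, not just of marginals, is needed because the modulus of
continuity is averaged over particles. -/
theorem IsStdBrownian.map_path_eq {Ω : Type*} [MeasurableSpace Ω] {P : Measure Ω}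
    [IsProbabilityMeasure P] {d : ℕ} {W W' : ℝ≥0 → Ω → EuclideanSpace ℝ (Fin d)}
    (hW : IsStdBrownian W P) (hW' : IsStdBrownian W' P) (hm : ∀ t, Measurable (W t))
    (hm' : ∀ t, Measurable (W' t)) :
    P.map (fun ω t => W t ω) = P.map (fun ω t => W' t ω) := by
  have hcm : ∀ {V : ℝ≥0 → Ω → EuclideanSpace ℝ (Fin d)}, (∀ t, Measurable (V t)) → ∀ j : Fin d,
      Measurable fun ω (t : ℝ≥0) => V t ω j := fun {V} hV j =>
    measurable_pi_lambda _ fun t =>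
      (EuclideanSpace.proj j : EuclideanSpace ℝ (Fin d) →L[ℝ] ℝ).continuous.measurable.comp (hV t)
  have hcoord : ∀ j, P.map (fun ω t => W t ω j) = P.map (fun ω t => W' t ω j) := fun j =>
    (map_eq_iff_forall_finset_map_restrict_eq (X := fun t ω => W t ω j)
      (Y := fun t ω => W' t ω j) (hcm hm j).aemeasurable (hcm hm' j).aemeasurable).2 fun I =>
      ((hW.coord j).hasLaw I).map_eq.trans ((hW'.coord j).hasLaw I).map_eq.symm
  have hpi : P.map (fun ω j t => W t ω j) = P.map (fun ω j t => W' t ω j) := by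
    rw [hW.indep.map_fun_eq_pi_map fun j => (hcm hm j).aemeasurable,
      hW'.indep.map_fun_eq_pi_map fun j => (hcm hm' j).aemeasurable]
    exact congrArg Measure.pi (funext hcoord)
  have hG : Measurable fun (y : Fin d → ℝ≥0 → ℝ) (t : ℝ≥0) =>
      (WithLp.toLp 2 fun j => y j t : EuclideanSpace ℝ (Fin d)) :=
    measurable_pi_lambda _ fun t => (PiLp.continuous_toLp 2 _).measurable.comp (by fun_prop)
  have h := congrArg (Measure.map fun (y : Fin d → ℝ≥0 → ℝ) (t : ℝ≥0) =>
    (WithLp.toLp 2 fun j => y j t : EuclideanSpace ℝ (Fin d))) hpi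
  rw [Measure.map_map hG (measurable_pi_lambda _ (hcm hm)),
    Measure.map_map hG (measurable_pi_lambda _ (hcm hm'))] at h
  exact h

/-! ### The probabilistic input -/

/-- i.i.d. pairs of Brownian paths, all of them continuous, and independent exponential
thresholds. -/
structure ParticleModel {Ω E : Type*} [MeasurableSpace Ω] [NormedAddCommGroup E]
    [InnerProductSpace ℝ E] [FiniteDimensional ℝ E] [MeasurableSpace E] [BorelSpace E]
    (P : Measure Ω) (B : ℕ → ℝ≥0 → Ω → E) (X : ℕ → Ω → ℝ) : Prop where
  measurable_position : ∀ i t, Measurable (B i t)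
  continuous_path : ∀ i ω, Continuous fun t => B i t ω
  measurable_threshold : ∀ i, Measurable (X i)
  law_position : ∀ i (t : ℝ≥0), P.map (B i t) = (stdGaussian E).map fun z => √(t : ℝ) • z
  law_threshold : ∀ i, P.map (X i) = expMeasure 1
  map_path : ∀ i, P.map (fun ω t => B i t ω) = P.map (fun ω t => B 0 t ω)
  indep : ∀ i, IndepFun (fun ω t => B i t ω) (X i) P
  indep_pair : ∀ i j, i ≠ j → IndepFun (fun ω => ((fun t => B i t ω : ℝ≥0 → E), X i ω))
    (fun ω => ((fun t => B j t ω : ℝ≥0 → E), X j ω)) P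

/-- Brownian paths are continuous only almost surely. Setting them to zero on a measurable null set
makes all of them continuous and changes neither laws nor independence. -/
theorem exists_particleModel {Ω : Type*} [MeasurableSpace Ω] {P : Measure Ω}
    [IsProbabilityMeasure P] {d : ℕ} {B : ℕ → ℝ≥0 → Ω → EuclideanSpace ℝ (Fin d)}
    (hB_meas : ∀ i t, Measurable (B i t)) (hB : ∀ i, IsStdBrownian (B i) P)
    (hB_indep : iIndepFun (fun i ω (t : ℝ≥0) => B i t ω) P) {X : ℕ → Ω → ℝ}
    (hX_meas : ∀ i, Measurable (X i)) (hX : ∀ i, HasLaw (X i) (expMeasure 1) P)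
    (hX_indep : iIndepFun X P)
    (hBX : IndepFun (fun ω (i : ℕ) (t : ℝ≥0) => B i t ω) (fun ω (i : ℕ) => X i ω) P) :
    ∃ B' : ℕ → ℝ≥0 → Ω → EuclideanSpace ℝ (Fin d), ParticleModel P B' X ∧
      ∀ᵐ ω ∂P, ∀ i t, B' i t ω = B i t ω := by
  have hcont : ∀ᵐ ω ∂P, ∀ i, Continuous fun t => B i t ω := by
    rw [ae_all_iff]
    intro i
    have h : ∀ᵐ ω ∂P, ∀ j, Continuous fun t => B i t ω j :=
      ae_all_iff.2 fun j => ((hB i).coord j).cont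
    filter_upwards [h] with ω hω
    exact (PiLp.continuous_toLp 2 _).comp (continuous_pi hω)
  obtain ⟨N, hN1, hN2, hN3⟩ := exists_measurable_superset_of_null (ae_iff.1 hcont)
  classical
  set B' : ℕ → ℝ≥0 → Ω → EuclideanSpace ℝ (Fin d) := fun i t ω => if ω ∈ N then 0 else B i t ω
    with hB'
  have hae : ∀ᵐ ω ∂P, ∀ i t, B' i t ω = B i t ω := by
    have : ∀ᵐ ω ∂P, ω ∉ N := measure_eq_zero_iff_ae_notMem.1 hN3
    filter_upwards [this] with ω hω i t
    simp [hB', hω]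
  have hpath : ∀ i, (fun ω t => B' i t ω) =ᵐ[P] fun ω t => B i t ω := fun i => by
    filter_upwards [hae] with ω hω
    exact funext (hω i)
  have hm' : ∀ i t, Measurable (B' i t) := fun i t =>
    Measurable.ite hN2 measurable_const (hB_meas i t)
  have hpm : ∀ i, Measurable fun ω t => B i t ω := fun i => measurable_pi_lambda _ (hB_meas i)
  have hpm' : ∀ i, Measurable fun ω t => B' i t ω := fun i => measurable_pi_lambda _ (hm' i)
  refine ⟨B', ⟨hm', fun i ω => ?_, hX_meas, fun i t => ?_, fun i => (hX i).map_eq, fun i => ?_,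
    fun i => ?_, fun i j hij => ?_⟩, hae⟩
  · by_cases hω : ω ∈ N
    · simpa [hB', hω] using continuous_const
    · have : ∀ i, Continuous fun t => B i t ω := by
        by_contra h
        exact hω (hN1 h)
      simpa [hB', hω] using this i
  · rw [← (hB i).map_eq t]
    refine Measure.map_congr ?_
    filter_upwards [hae] with ω hω using hω i t
  · rw [Measure.map_congr (hpath i), Measure.map_congr (hpath 0)]
    exact (hB i).map_path_eq (hB 0) (hB_meas i) (hB_meas 0)
  · exact (hBX.comp (measurable_pi_apply i) (measurable_pi_apply i)).congr (hpath i).symm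
      EventuallyEq.rfl
  · have h1 : IndepFun (fun ω t => B i t ω) (fun ω t => B j t ω) P := hB_indep.indepFun hij
    have h2 := ProbabilityTheory.IndepFun.prodMk_prodMk (hpm i) (hpm j) (hX_meas i) (hX_meas j)
      h1 (hX_indep.indepFun hij)
      (hBX.comp (φ := fun w : ℕ → ℝ≥0 → EuclideanSpace ℝ (Fin d) => (w i, w j))
        (ψ := fun x : ℕ → ℝ => (x i, x j)) (by fun_prop) (by fun_prop))
    refine h2.congr ?_ ?_
    · filter_upwards [hpath i] with ω hω
      exact Prod.ext hω.symm rfl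
    · filter_upwards [hpath j] with ω hω
      exact Prod.ext hω.symm rfl

/-! ### The law of large numbers in `L¹`, with a rate -/

section LawOfLargeNumbers

variable {Ω : Type*} [MeasurableSpace Ω] {P : Measure Ω} [IsProbabilityMeasure P]

/-- The `L¹` norm is at most the `L²` norm, and variances add under pairwise independence. -/
theorem lintegral_enorm_avg_sub_le {Y : ℕ → Ω → ℝ} (hY : ∀ i, MemLp (Y i) 2 P)
    (hind : ∀ i j, i ≠ j → IndepFun (Y i) (Y j) P) {m V : ℝ} (hm : ∀ i, ∫ ω, Y i ω ∂P = m)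
    (hV : ∀ i, ∫ ω, Y i ω ^ 2 ∂P ≤ V) {n : ℕ} (hn : 1 ≤ n) :
    ∫⁻ ω, ‖(∑ i ∈ Finset.range n, (n : ℝ)⁻¹ * Y i ω) - m‖ₑ ∂P ≤ ENNReal.ofReal √(V / n) := by
  have hn0 : (0 : ℝ) < n := by exact_mod_cast hn
  set Z : Ω → ℝ := fun ω => (n : ℝ)⁻¹ * (∑ i ∈ Finset.range n, Y i) ω with hZ
  have hZe : ∀ ω, ∑ i ∈ Finset.range n, (n : ℝ)⁻¹ * Y i ω = Z ω := fun ω => by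
    simp [hZ, Finset.mul_sum]
  have hsum : MemLp (∑ i ∈ Finset.range n, Y i) 2 P := memLp_finsetSum' _ fun i _ => hY i
  have hZL : MemLp Z 2 P := hsum.const_mul _
  have hYi : ∀ i, Integrable (Y i) P := fun i => (hY i).integrable one_le_two
  have hZm : ∫ ω, Z ω ∂P = m := by
    simp only [← hZe]
    rw [integral_finsetSum _ fun i _ => (hYi i).const_mul _]
    simp only [integral_const_mul, hm, Finset.sum_const, Finset.card_range, nsmul_eq_mul]
    field_simp
  have hvar : Var[Z; P] ≤ V / n := by
    rw [hZ, variance_const_mul, IndepFun.variance_sum (fun i _ => hY i)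
      fun i _ j _ hij => hind i j hij]
    have : ∑ i ∈ Finset.range n, Var[Y i; P] ≤ ∑ i ∈ Finset.range n, V :=
      Finset.sum_le_sum fun i _ => by
        rw [variance_eq_sub (hY i)]
        have := hV i
        have h2 := sq_nonneg (∫ ω, Y i ω ∂P)
        simp only [Pi.pow_apply]
        linarith
    calc ((n : ℝ)⁻¹) ^ 2 * ∑ i ∈ Finset.range n, Var[Y i; P]
        ≤ ((n : ℝ)⁻¹) ^ 2 * ∑ i ∈ Finset.range n, V := by gcongr
      _ = V / n := by simp; field_simp
  have hW : MemLp (fun ω => Z ω - m) 2 P := hZL.sub (memLp_const m)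
  have hWn : MemLp (fun ω => ‖Z ω - m‖) 2 P := hW.norm
  have hW2 : ∫ ω, (Z ω - m) ^ 2 ∂P = Var[Z; P] := by
    rw [variance_eq_integral hZL.aestronglyMeasurable.aemeasurable, hZm]
  -- Cauchy–Schwarz, in the form that the variance of `‖Z - m‖` is nonnegative.
  have h1 : (∫ ω, ‖Z ω - m‖ ∂P) ^ 2 ≤ V / n := by
    have h := variance_nonneg (fun ω => ‖Z ω - m‖) P
    rw [variance_eq_sub hWn] at h
    simp only [Pi.pow_apply, Real.norm_eq_abs, sq_abs] at h ⊢
    rw [hW2] at h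
    linarith
  simp only [hZe]
  rw [← ofReal_integral_norm_eq_lintegral_enorm (hW.integrable one_le_two)]
  exact ENNReal.ofReal_le_ofReal (Real.le_sqrt_of_sq_le h1)

theorem tendsto_sqrt_div (V : ℝ) :
    Tendsto (fun n : ℕ => ENNReal.ofReal √(V / n)) atTop (𝓝 0) := by
  have h := ENNReal.tendsto_ofReal
    ((Real.continuous_sqrt.tendsto 0).comp (tendsto_const_div_atTop_nhds_zero_nat V))
  simpa using h

end LawOfLargeNumbers

/-! ### The limiting clock -/

section LimitClock

variable {E : Type*} [NormedAddCommGroup E] [InnerProductSpace ℝ E] [FiniteDimensional ℝ E]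
  [MeasurableSpace E] {ζ : E → ℝ} {K : ℝ}

/-- The limit of the killing clocks. -/
noncomputable def limitClock (ζ : E → ℝ) (t : ℝ) : ℝ :=
  Real.log (1 + ∫ s in (0 : ℝ)..t, gaussianRate ζ s)

theorem exp_neg_limitClock (hζ0 : ∀ y, 0 ≤ ζ y) {t : ℝ} (ht : 0 ≤ t) :
    Real.exp (-limitClock ζ t) = gaussianSurvival ζ t := by
  have := one_le_gaussianSurvival_denom hζ0 ht
  rw [limitClock, Real.exp_neg, Real.exp_log (by linarith), gaussianSurvival, one_div]

theorem limitClock_nonneg (hζ0 : ∀ y, 0 ≤ ζ y) {t : ℝ} (ht : 0 ≤ t) : 0 ≤ limitClock ζ t :=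
  Real.log_nonneg (one_le_gaussianSurvival_denom hζ0 ht)

variable [BorelSpace E]

theorem measurable_limitClock (hζ : Continuous ζ) (hK : QuadraticGrowth ζ K) :
    Measurable (limitClock ζ) :=
  Real.measurable_log.comp (continuous_const.add (intervalIntegral.continuous_primitive
    (fun _ _ => (continuous_gaussianRate hζ hK).intervalIntegrable _ _) 0)).measurable

theorem continuousOn_rate_mul_survival (hζ : Continuous ζ) (hζ0 : ∀ y, 0 ≤ ζ y)
    (hK : QuadraticGrowth ζ K) :
    ContinuousOn (fun s => gaussianRate ζ s * gaussianSurvival ζ s) (Ici 0) :=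
  (continuous_gaussianRate hζ hK).continuousOn.mul (continuousOn_gaussianSurvival hζ hζ0 hK)

theorem intervalIntegrable_rate_mul_survival (hζ : Continuous ζ) (hζ0 : ∀ y, 0 ≤ ζ y)
    (hK : QuadraticGrowth ζ K) {t : ℝ} (ht : 0 ≤ t) :
    IntervalIntegrable (fun s => gaussianRate ζ s * gaussianSurvival ζ s) volume 0 t :=
  ((continuousOn_rate_mul_survival hζ hζ0 hK).mono
    (by rw [uIcc_of_le ht]; exact Icc_subset_Ici_self)).intervalIntegrable

/-- Differentiating the logarithm gives `b / (1 + ∫ b) = b e^{-Λ}`: the limiting clock solves the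
averaged clock equation. -/
theorem limitClock_eq_integral (hζ : Continuous ζ) (hζ0 : ∀ y, 0 ≤ ζ y)
    (hK : QuadraticGrowth ζ K) {t : ℝ} (ht : 0 ≤ t) :
    limitClock ζ t = ∫ s in (0 : ℝ)..t, gaussianRate ζ s * gaussianSurvival ζ s := by
  have hb := continuous_gaussianRate hζ hK
  have hd : ∀ s ∈ uIcc 0 t,
      HasDerivAt (limitClock ζ) (gaussianRate ζ s * gaussianSurvival ζ s) s := by
    intro s hs
    rw [uIcc_of_le ht] at hs
    have h1 : HasDerivAt (fun t => 1 + ∫ s in (0 : ℝ)..t, gaussianRate ζ s)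
        (gaussianRate ζ s) s :=
      (intervalIntegral.integral_hasDerivAt_right (hb.intervalIntegrable _ _)
        (hb.stronglyMeasurableAtFilter _ _) hb.continuousAt).const_add 1
    have := one_le_gaussianSurvival_denom hζ0 hs.1
    refine (h1.log (by linarith)).congr_deriv ?_
    rw [gaussianSurvival, mul_one_div]
  rw [intervalIntegral.integral_eq_sub_of_hasDerivAt hd
    (intervalIntegrable_rate_mul_survival hζ hζ0 hK ht)]
  simp [limitClock]

/-- The distance between the rate of the particle system along the limiting clock, and its
limit. -/
noncomputable def clockError (T : ℝ≥0) (ζ : E → ℝ) (n : ℕ) (b : ℕ → ℝ≥0 → E) (x : ℕ → ℝ) : ℝ≥0∞ :=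
  ∫⁻ s in Ioc (0 : ℝ) T, ‖killingRate (Finset.range n) (particleRate ζ n b) x s (limitClock ζ s)
    - gaussianRate ζ s * gaussianSurvival ζ s‖ₑ

/-- When `A` is ahead of `Λ`, monotonicity gives `F(s, A) ≤ F(s, Λ)`, so the gap grows no faster
than `|F(s, Λ) - v|`; likewise when it is behind. The error thus involves the random rate only along
the deterministic clock. -/
theorem IsKillingClock.abs_sub_limitClock_le (hζ : Continuous ζ) (hζ0 : ∀ y, 0 ≤ ζ y)
    (hK : QuadraticGrowth ζ K) {n : ℕ} {b : ℕ → ℝ≥0 → E} (hb : ∀ i, Continuous (b i))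
    {x : ℕ → ℝ} {A : ℝ → ℝ} (hA : IsKillingClock (Finset.range n) (particleRate ζ n b) x A)
    {T : ℝ≥0} {t : ℝ} (ht : t ∈ Icc (0 : ℝ) T) :
    ENNReal.ofReal |A t - limitClock ζ t| ≤ clockError T ζ n b x := by
  have hg := continuous_particleRate (n := n) hζ hb
  have hg0 := particleRate_nonneg (n := n) (b := b) hζ0
  set F := killingRate (Finset.range n) (particleRate ζ n b) x with hF
  have hanti : ∀ s, Antitone (F s) := killingRate_antitone hg0
  set v : ℝ → ℝ := fun s => gaussianRate ζ s * gaussianSurvival ζ s with hv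
  set r : ℝ → ℝ := fun s => |F s (limitClock ζ s) - v s| with hr
  have i1 : ∀ p q, IntervalIntegrable (fun s => F s (A s)) volume p q :=
    intervalIntegrable_killingRate hg hg0 hA.continuous.measurable
  have i2 : ∀ p q, IntervalIntegrable (fun s => F s (limitClock ζ s)) volume p q :=
    intervalIntegrable_killingRate hg hg0 (measurable_limitClock hζ hK)
  have i3 : ∀ p, 0 ≤ p → IntervalIntegrable v volume 0 p := fun p hp =>
    intervalIntegrable_rate_mul_survival hζ hζ0 hK hp
  have hT : (0 : ℝ) ≤ T := T.2
  have ir : ∀ p, 0 ≤ p → IntervalIntegrable r volume 0 p := fun p hp => ((i2 0 p).sub (i3 p hp)).abs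
  have hA0 : A 0 = 0 := by simpa using hA.eq 0 le_rfl
  have hl0 : limitClock ζ 0 = 0 := by simp [limitClock]
  have hint : ∀ s, 0 ≤ s → A s - limitClock ζ s = ∫ u in (0 : ℝ)..s, (F u (A u) - v u) := by
    intro s hs
    rw [hA.eq s hs, limitClock_eq_integral hζ hζ0 hK hs,
      intervalIntegral.integral_sub (i1 0 s) (i3 s hs)]
  have h1 : A t - limitClock ζ t ≤ ∫ s in (0 : ℝ)..t, r s := by
    refine le_integral_of_le_of_pos (D := fun s => A s - limitClock ζ s) ht.1
      ((i1 0 t).sub (i3 t ht.1)) (ir t ht.1) (fun s hs => ?_) (by simp [hA0, hl0])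
      (fun s _ => abs_nonneg _) (fun s _ hpos => ?_)
    · simp only [hA0, hl0, sub_zero, zero_add]
      exact hint s hs.1
    · have := hanti s (show limitClock ζ s ≤ A s by linarith)
      exact (sub_le_sub_right this _).trans (le_abs_self _)
  have h2 : limitClock ζ t - A t ≤ ∫ s in (0 : ℝ)..t, r s := by
    refine le_integral_of_le_of_pos (D := fun s => limitClock ζ s - A s)
      (k := fun u => -(F u (A u) - v u)) ht.1
      ((i1 0 t).sub (i3 t ht.1)).neg (ir t ht.1) (fun s hs => ?_) (by simp [hA0, hl0])
      (fun s _ => abs_nonneg _) (fun s _ hpos => ?_)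
    · simp only [hA0, hl0, sub_zero, zero_add, intervalIntegral.integral_neg]
      rw [← hint s hs.1]; ring
    · have := hanti s (show A s ≤ limitClock ζ s by linarith)
      exact (neg_le_neg (sub_le_sub_right this _)).trans (neg_le_abs _)
  have h3 : ∫ s in (0 : ℝ)..t, r s ≤ ∫ s in (0 : ℝ)..T, r s :=
    intervalIntegral.integral_mono_interval le_rfl ht.1 ht.2
      (ae_of_all _ fun s => abs_nonneg _) (ir T hT)
  have h4 : ENNReal.ofReal (∫ s in (0 : ℝ)..T, r s) = clockError T ζ n b x := by
    rw [intervalIntegral.integral_of_le hT, ofReal_integral_eq_lintegral_ofReal (ir T hT).1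
      (ae_of_all _ fun s => abs_nonneg _), clockError]
    refine lintegral_congr fun s => ?_
    rw [← ofReal_norm, Real.norm_eq_abs]
  rw [← h4]
  exact ENNReal.ofReal_le_ofReal ((abs_le.2 ⟨by linarith, h1⟩).trans h3)

end LimitClock

/-- Negative `c` occurs for the windows `c ± η` around a small clock value. -/
theorem measureReal_expMeasure_Ioi (c : ℝ) :
    (expMeasure 1).real (Ioi c) = Real.exp (-max c 0) := by
  have := isProbabilityMeasure_expMeasure one_pos
  have h := cdf_expMeasure_eq one_pos c
  rw [cdf_eq_real] at h
  rw [← compl_Iic, probReal_compl_eq_one_sub measurableSet_Iic, h]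
  rcases le_or_gt 0 c with hc | hc
  · simp [hc]
  · simp [hc.not_ge, max_eq_right hc.le]

namespace ParticleModel

variable {Ω E : Type*} [MeasurableSpace Ω] [NormedAddCommGroup E]
    [InnerProductSpace ℝ E] [FiniteDimensional ℝ E] [MeasurableSpace E] [BorelSpace E]
    {P : Measure Ω} {B : ℕ → ℝ≥0 → Ω → E} {X : ℕ → Ω → ℝ}
    {ζ : E → ℝ} {K : ℝ}

/-! ### Measurability of the clock -/

theorem measurable_particleRate (h : ParticleModel P B X) (hζ : Continuous ζ) (n i : ℕ) :
    Measurable fun q : Ω × ℝ => particleRate ζ n (fun j t => B j t q.1) i q.2 := by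
  have h1 : Measurable (Function.uncurry fun (t : ℝ≥0) ω => B i t ω) :=
    measurable_uncurry_of_continuous_of_measurable (fun ω => h.continuous_path i ω)
      (h.measurable_position i)
  have h2 : Measurable fun q : Ω × ℝ => (q.2.toNNReal, q.1) := by fun_prop
  exact (hζ.measurable.comp (h1.comp h2)).const_mul _

theorem measurable_killingRate (h : ParticleModel P B X) (hζ : Continuous ζ) (n : ℕ)
    {c : Ω × ℝ → ℝ} (hc : Measurable c) :
    Measurable fun q : Ω × ℝ => killingRate (Finset.range n)
      (particleRate ζ n fun j t => B j t q.1) (fun j => X j q.1) q.2 (c q) := by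
  refine Finset.measurable_sum _ fun i _ => Measurable.ite ?_ (h.measurable_particleRate hζ n i)
    measurable_const
  exact measurableSet_lt hc ((h.measurable_threshold i).comp measurable_fst)

theorem measurable_eulerClock (h : ParticleModel P B X) (hζ : Continuous ζ) (n : ℕ) (δ : ℝ)
    (j : ℕ) : Measurable fun ω => eulerClock (Finset.range n)
      (particleRate ζ n fun j t => B j t ω) (fun j => X j ω) δ j := by
  induction j with
  | zero => exact measurable_const
  | succ j ih =>
    simp only [eulerClock]
    refine ih.add ?_
    have hj := (h.measurable_killingRate hζ n (ih.comp measurable_fst)).stronglyMeasurable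
    exact (hj.integral_prod_right'.measurable.sub hj.integral_prod_right'.measurable)

/-- The clocks are chosen separately for each `ω`; measurability is recovered from the Euler
approximations, which converge for every `ω`. -/
theorem exists_measurable_clock (h : ParticleModel P B X) (hζ : Continuous ζ)
    (hζ0 : ∀ y, 0 ≤ ζ y) (n : ℕ) :
    ∃ A : Ω → ℝ → ℝ, (∀ ω, IsKillingClock (Finset.range n)
      (particleRate ζ n fun j t => B j t ω) (fun j => X j ω) (A ω)) ∧
      ∀ t, 0 ≤ t → Measurable fun ω => A ω t := by
  choose A hA using fun ω => exists_isKillingClock hζ hζ0 n (fun i => h.continuous_path i ω)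
    (fun j => X j ω)
  refine ⟨A, hA, fun t ht => ?_⟩
  refine measurable_of_tendsto_metrizable (fun k => h.measurable_eulerClock hζ n
    (t / (k + 1 : ℕ)) (k + 1)) (tendsto_pi_nhds.2 fun ω => ?_)
  exact tendsto_eulerClock (continuous_particleRate hζ fun i => h.continuous_path i ω)
    (particleRate_nonneg hζ0) (hA ω).continuous (hA ω).monotone (hA ω).eq ht

/-! ### Moments of the contributions of single particles -/

/-- At a deterministic clock value, position and survival are independent, and the exponential
threshold survives with probability `e^{-c}`. -/
theorem integral_alive (h : ParticleModel P B X) {F : E → ℝ} (hF : Measurable F) (i : ℕ)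
    {t c : ℝ} (ht : 0 ≤ t) (hc : 0 ≤ c) :
    ∫ ω, (if c < X i ω then F (B i t.toNNReal ω) else 0) ∂P
      = (∫ z, F (√t • z) ∂(stdGaussian E)) * Real.exp (-c) := by
  have h1 : ∀ ω, (if c < X i ω then F (B i t.toNNReal ω) else 0)
      = F (B i t.toNNReal ω) * (Ioi c).indicator 1 (X i ω) := fun ω => by
    by_cases hx : c < X i ω <;> simp [hx]
  simp only [h1]
  have hind : IndepFun (fun ω => F (B i t.toNNReal ω))
      (fun ω => (Ioi c).indicator (1 : ℝ → ℝ) (X i ω)) P :=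
    (h.indep i).comp (hF.comp (measurable_pi_apply t.toNNReal))
      (measurable_one.indicator measurableSet_Ioi)
  have hm1 : Measurable fun ω => F (B i t.toNNReal ω) := hF.comp (h.measurable_position i _)
  have hm2 : Measurable fun ω => (Ioi c).indicator (1 : ℝ → ℝ) (X i ω) :=
    (measurable_one.indicator measurableSet_Ioi).comp (h.measurable_threshold i)
  rw [hind.integral_fun_mul_eq_mul_integral hm1.aestronglyMeasurable hm2.aestronglyMeasurable]
  congr 1
  · rw [← integral_map (h.measurable_position i _).aemeasurable hF.aestronglyMeasurable,
      h.law_position, integral_map (by fun_prop) hF.aestronglyMeasurable,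
      Real.coe_toNNReal _ ht]
  · rw [← integral_map (h.measurable_threshold i).aemeasurable
      (measurable_one.indicator measurableSet_Ioi).aestronglyMeasurable, h.law_threshold,
      integral_indicator_one measurableSet_Ioi, measureReal_expMeasure_Ioi, max_eq_left hc]

theorem integral_position (h : ParticleModel P B X) {F : E → ℝ} (hF : Measurable F) (i : ℕ)
    (t : ℝ≥0) : ∫ ω, F (B i t ω) ∂P = ∫ z, F (√(t : ℝ) • z) ∂(stdGaussian E) := by
  rw [← integral_map (h.measurable_position i _).aemeasurable hF.aestronglyMeasurable,
      h.law_position, integral_map (by fun_prop) hF.aestronglyMeasurable]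

/-- By Tonelli the expectation is taken at a fixed time, where the summands are pairwise independent
with mean `b e^{-Λ}` and uniformly bounded second moments. -/
theorem lintegral_clockError_le [IsProbabilityMeasure P] (h : ParticleModel P B X) (hζ : Continuous ζ)
    (hζ0 : ∀ y, 0 ≤ ζ y) (hK : QuadraticGrowth ζ K) (T : ℝ≥0) {n : ℕ} (hn : 1 ≤ n) :
    ∫⁻ ω, clockError T ζ n (fun i t => B i t ω) (fun i => X i ω) ∂P ≤
      ENNReal.ofReal √((∫ z : E, (K * (1 + T * ‖z‖ ^ 2)) ^ 2 ∂(stdGaussian E)) / n) * T := by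
  have hm := h.measurable_killingRate hζ n
    ((measurable_limitClock hζ hK).comp (measurable_snd (α := Ω) (β := ℝ)))
  have hT : (0 : ℝ) ≤ T := T.2
  have hv : AEMeasurable (fun s => gaussianRate ζ s * gaussianSurvival ζ s)
      (volume.restrict (Ioc (0 : ℝ) T)) :=
    (intervalIntegrable_rate_mul_survival hζ hζ0 hK hT).1.aestronglyMeasurable.aemeasurable
  simp only [clockError]
  rw [lintegral_lintegral_swap]
  · calc _ ≤ ∫⁻ s in Ioc (0 : ℝ) T, ENNReal.ofReal
          √((∫ z : E, (K * (1 + T * ‖z‖ ^ 2)) ^ 2 ∂(stdGaussian E)) / n) := by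
          refine setLIntegral_mono' measurableSet_Ioc fun s hs => ?_
          have hs0 : 0 ≤ s := hs.1.le
          have hc0 := limitClock_nonneg hζ0 hs0
          set Y : ℕ → Ω → ℝ := fun i ω =>
            if limitClock ζ s < X i ω then ζ (B i s.toNNReal ω) else 0 with hY
          have hYm : ∀ i, Measurable (Y i) := fun i =>
            Measurable.ite (measurableSet_lt measurable_const (h.measurable_threshold i))
              (hζ.measurable.comp (h.measurable_position i _)) measurable_const
          have hsq := hK.integrable_sq_scaled hζ s
          have hζ2 : ∀ i, Integrable (fun ω => ζ (B i s.toNNReal ω) ^ 2) P := fun i => by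
            have h1 : Integrable (fun y => ζ y ^ 2) (P.map (B i s.toNNReal)) := by
              rw [h.law_position, Real.coe_toNNReal _ hs0]
              exact (integrable_map_measure (hζ.pow 2).aestronglyMeasurable (by fun_prop)).2
                hsq.1
            exact (integrable_map_measure (hζ.pow 2).aestronglyMeasurable
              (h.measurable_position i _).aemeasurable).1 h1
          have hle : ∀ i ω, Y i ω ^ 2 ≤ ζ (B i s.toNNReal ω) ^ 2 := fun i ω => by
            by_cases hx : limitClock ζ s < X i ω <;> simp [hY, hx, sq_nonneg]
          have hY2 : ∀ i, Integrable (fun ω => Y i ω ^ 2) P := fun i => by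
            refine (hζ2 i).mono' ((hYm i).pow_const 2).aestronglyMeasurable
              (ae_of_all _ fun ω => ?_)
            rw [Real.norm_of_nonneg (sq_nonneg _)]
            exact hle i ω
          have key := lintegral_enorm_avg_sub_le (P := P) (Y := Y)
            (fun i => (memLp_two_iff_integrable_sq (hYm i).aestronglyMeasurable).2 (hY2 i))
            (fun i j hij => (h.indep_pair i j hij).comp
              (φ := fun q : (ℝ≥0 → E) × ℝ => if limitClock ζ s < q.2 then ζ (q.1 s.toNNReal) else 0)
              (ψ := fun q : (ℝ≥0 → E) × ℝ => if limitClock ζ s < q.2 then ζ (q.1 s.toNNReal) else 0)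
              (Measurable.ite (measurableSet_lt measurable_const measurable_snd)
                (hζ.measurable.comp ((measurable_pi_apply _).comp measurable_fst))
                measurable_const)
              (Measurable.ite (measurableSet_lt measurable_const measurable_snd)
                (hζ.measurable.comp ((measurable_pi_apply _).comp measurable_fst))
                measurable_const))
            (m := gaussianRate ζ s * gaussianSurvival ζ s)
            (V := ∫ z : E, (K * (1 + T * ‖z‖ ^ 2)) ^ 2 ∂(stdGaussian E))
            (fun i => by
              rw [← exp_neg_limitClock hζ0 hs0]
              exact h.integral_alive hζ.measurable i hs0 hc0)
            (fun i => by
              refine (integral_mono (hY2 i) (hζ2 i) (hle i)).trans ?_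
              rw [h.integral_position (F := fun y => ζ y ^ 2) (hζ.measurable.pow_const 2),
                Real.coe_toNNReal _ hs0]
              exact hsq.2 T hT hs.2) hn
          refine le_trans (le_of_eq (lintegral_congr fun ω => ?_)) key
          congr 2
          refine Finset.sum_congr rfl fun i _ => ?_
          by_cases hx : limitClock ζ s < X i ω <;> simp [hY, hx, particleRate]
      _ = _ := by
          rw [setLIntegral_const, Real.volume_Ioc, sub_zero, ENNReal.ofReal_coe_nnreal]
  · exact ((hm.aemeasurable (μ := P.prod (volume.restrict (Ioc (0 : ℝ) T)))).sub
      (hv.comp_snd)).enorm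

theorem aemeasurable_clockError (h : ParticleModel P B X) (hζ : Continuous ζ)
    (hζ0 : ∀ y, 0 ≤ ζ y) (hK : QuadraticGrowth ζ K) (T : ℝ≥0) (n : ℕ) :
    AEMeasurable (fun ω => clockError T ζ n (fun i t => B i t ω) (fun i => X i ω)) P := by
  have hm := h.measurable_killingRate hζ n
    ((measurable_limitClock hζ hK).comp (measurable_snd (α := Ω) (β := ℝ)))
  have hv : AEMeasurable (fun s => gaussianRate ζ s * gaussianSurvival ζ s)
      (volume.restrict (Ioc (0 : ℝ) T)) :=
    (intervalIntegrable_rate_mul_survival hζ hζ0 hK T.2).1.aestronglyMeasurable.aemeasurable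
  exact AEMeasurable.lintegral_prod_right'
    ((hm.aemeasurable (μ := P.prod (volume.restrict (Ioc (0 : ℝ) T)))).sub (hv.comp_snd)).enorm

end ParticleModel

/-! ### Finite nets of test functions -/

/-- The functions that test the bounded-Lipschitz distance. -/
abbrev BLUnit (E : Type*) [PseudoEMetricSpace E] : Type _ :=
  {f : E → ℝ // (∀ x, |f x| ≤ 1) ∧ LipschitzWith 1 f}

/-- By Arzelà–Ascoli the restrictions to `S` are totally bounded. Net points are lifted back to test
functions on the whole space. -/
theorem exists_finite_net_BLUnit {E : Type*} [PseudoMetricSpace E] {S : Set E} (hS : IsCompact S)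
    {ε : ℝ} (hε : 0 < ε) : ∃ F : Set (BLUnit E), F.Finite ∧
      ∀ f : BLUnit E, ∃ g ∈ F, ∀ y ∈ S, |f.1 y - g.1 y| ≤ ε := by
  have : CompactSpace S := isCompact_iff_compactSpace.1 hS
  have : Nonempty (BLUnit E) := ⟨⟨fun _ => 0, by simp, LipschitzWith.const' 0⟩⟩
  set res : BLUnit E → BoundedContinuousFunction S ℝ := fun f =>
    BoundedContinuousFunction.mkOfCompact ⟨fun y => f.1 y, f.2.2.continuous.comp
      continuous_subtype_val⟩ with hres
  have hcomp : IsCompact (closure (range res)) := by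
    refine BoundedContinuousFunction.arzela_ascoli (Icc (-1) 1) isCompact_Icc _ ?_ ?_
    · rintro _ y ⟨f, rfl⟩
      exact abs_le.1 (f.2.1 y)
    · refine UniformEquicontinuous.equicontinuous
        (LipschitzWith.uniformEquicontinuous _ 1 ?_)
      rintro ⟨_, f, rfl⟩
      have h := f.2.2.comp (LipschitzWith.subtype_val S)
      rw [one_mul] at h
      exact h
  obtain ⟨t, ht1, ht2, ht3⟩ := Metric.finite_approx_of_totallyBounded
    (hcomp.totallyBounded.subset subset_closure) ε hε
  refine ⟨Function.invFun res '' t, ht2.image _, fun f => ?_⟩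
  obtain ⟨w, hw1, hw2⟩ := mem_iUnion₂.1 (ht3 (mem_range_self f))
  refine ⟨_, mem_image_of_mem _ hw1, fun y hy => ?_⟩
  have hinv : res (Function.invFun res w) = w := Function.invFun_eq (ht1 hw1)
  have h1 : dist (res f ⟨y, hy⟩) (res (Function.invFun res w) ⟨y, hy⟩) ≤ ε := by
    rw [hinv]
    exact (BoundedContinuousFunction.dist_coe_le_dist _).trans (Metric.mem_ball.1 hw2).le
  exact h1

/-! ### The modulus of continuity of a path -/

section Modulus

variable {E : Type*} [NormedAddCommGroup E]

/-- The truncated modulus of continuity of a path on a neighbourhood of `[0,T]`, as a supremum over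
a countable set. -/
noncomputable def pathModulus (T : ℝ≥0) (δ : ℝ) (b : ℝ≥0 → E) : ℝ :=
  ⨆ p : ℕ × ℕ, if TopologicalSpace.denseSeq ℝ≥0 p.1 < T + 1 ∧
      TopologicalSpace.denseSeq ℝ≥0 p.2 < T + 1 ∧
      dist (TopologicalSpace.denseSeq ℝ≥0 p.1) (TopologicalSpace.denseSeq ℝ≥0 p.2) < δ then
    min 2 ‖b (TopologicalSpace.denseSeq ℝ≥0 p.1) - b (TopologicalSpace.denseSeq ℝ≥0 p.2)‖ else 0

theorem pathModulus_le {T : ℝ≥0} {δ : ℝ} {b : ℝ≥0 → E} {c : ℝ} (hc : 0 ≤ c)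
    (h : ∀ s t, s < T + 1 → t < T + 1 → dist s t < δ → min 2 ‖b s - b t‖ ≤ c) :
    pathModulus T δ b ≤ c := by
  refine ciSup_le fun p => ?_
  split_ifs with hp
  · exact h _ _ hp.1 hp.2.1 hp.2.2
  · exact hc

theorem pathModulus_nonneg (T : ℝ≥0) (δ : ℝ) (b : ℝ≥0 → E) : 0 ≤ pathModulus T δ b :=
  Real.iSup_nonneg fun p => by split_ifs <;> positivity

theorem pathModulus_le_two (T : ℝ≥0) (δ : ℝ) (b : ℝ≥0 → E) : pathModulus T δ b ≤ 2 :=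
  pathModulus_le zero_le_two fun _ _ _ _ _ => min_le_left _ _

theorem measurable_pathModulus [MeasurableSpace E] [BorelSpace E] [SecondCountableTopology E]
    (T : ℝ≥0) (δ : ℝ) : Measurable (pathModulus (E := E) T δ) := by
  refine Measurable.iSup fun p => ?_
  split_ifs
  · have h : Measurable fun b : ℝ≥0 → E => b (TopologicalSpace.denseSeq ℝ≥0 p.1) -
        b (TopologicalSpace.denseSeq ℝ≥0 p.2) := by fun_prop
    exact measurable_const.min h.norm
  · exact measurable_const

/-- The strict constraints with `T + 1` define an open set of pairs containing `(s, t)`, so the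
dense sequence approximates it from inside the set, even for `T = 0`. The truncation at `2` costs
nothing for test functions bounded by `1`. -/
theorem le_pathModulus {T : ℝ≥0} {δ : ℝ} {b : ℝ≥0 → E} (hb : Continuous b) {s t : ℝ≥0}
    (hs : s ≤ T) (ht : t ≤ T) (hst : dist s t < δ) : min 2 ‖b s - b t‖ ≤ pathModulus T δ b := by
  set u := TopologicalSpace.denseSeq ℝ≥0
  set U : Set (ℝ≥0 × ℝ≥0) := {q | q.1 < T + 1 ∧ q.2 < T + 1 ∧ dist q.1 q.2 < δ} with hU
  have hUo : IsOpen U := (isOpen_lt continuous_fst continuous_const).inter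
    ((isOpen_lt continuous_snd continuous_const).inter
      (isOpen_lt (continuous_fst.dist continuous_snd) continuous_const))
  have hd : DenseRange (Prod.map u u) :=
    (TopologicalSpace.denseRange_denseSeq ℝ≥0).prodMap (TopologicalSpace.denseRange_denseSeq ℝ≥0)
  have hC : IsClosed {q : ℝ≥0 × ℝ≥0 | min 2 ‖b q.1 - b q.2‖ ≤ pathModulus T δ b} :=
    isClosed_le (continuous_const.min
      ((hb.comp continuous_fst).sub (hb.comp continuous_snd)).norm) continuous_const
  have hsub : U ∩ range (Prod.map u u) ⊆
      {q : ℝ≥0 × ℝ≥0 | min 2 ‖b q.1 - b q.2‖ ≤ pathModulus T δ b} := by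
    rintro _ ⟨hq, p, rfl⟩
    have hbdd : BddAbove (range fun p : ℕ × ℕ =>
        if u p.1 < T + 1 ∧ u p.2 < T + 1 ∧ dist (u p.1) (u p.2) < δ then
          min 2 ‖b (u p.1) - b (u p.2)‖ else 0) := by
      refine ⟨2, ?_⟩
      rintro _ ⟨p, rfl⟩
      dsimp only
      split_ifs
      · exact min_le_left _ _
      · exact zero_le_two
    refine le_trans (le_of_eq ?_) (le_ciSup hbdd p)
    exact (if_pos hq).symm
  have hlt : T < T + 1 := lt_add_of_pos_right _ one_pos
  have hmem : (s, t) ∈ U := ⟨hs.trans_lt hlt, ht.trans_lt hlt, hst⟩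
  exact closure_minimal hsub hC (hd.open_subset_closure_inter hUo hmem)

theorem tendsto_pathModulus {T : ℝ≥0} {b : ℝ≥0 → E} (hb : Continuous b) :
    Tendsto (fun k : ℕ => pathModulus T (1 / (k + 1 : ℝ)) b) atTop (𝓝 0) := by
  have hu : UniformContinuousOn b (Icc 0 (T + 1)) :=
    isCompact_Icc.uniformContinuousOn_of_continuous hb.continuousOn
  rw [Metric.uniformContinuousOn_iff] at hu
  rw [Metric.tendsto_atTop]
  intro ε hε
  obtain ⟨δ, hδ, h⟩ := hu (ε / 2) (half_pos hε)
  obtain ⟨N, hN⟩ := exists_nat_one_div_lt hδ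
  refine ⟨N, fun k hk => ?_⟩
  rw [Real.dist_eq, sub_zero, abs_of_nonneg (pathModulus_nonneg _ _ _)]
  refine (pathModulus_le (half_pos hε).le fun s t hs ht hst => ?_).trans_lt (half_lt_self hε)
  refine (min_le_right _ _).trans ?_
  rw [← dist_eq_norm]
  refine (h s ⟨zero_le, hs.le⟩ t ⟨zero_le, ht.le⟩ (hst.trans (lt_of_le_of_lt ?_ hN))).le
  have : (N : ℝ) ≤ k := by exact_mod_cast hk
  gcongr

end Modulus

/-! ### A uniform law of large numbers -/

/-- A bracketing argument: replacing `φ k` by its net point `φ j` costs the empirical mean of `G j`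
plus its expectation, hence `2 * ε` and a fluctuation. Only finitely many laws of large numbers
remain. -/
theorem exists_uniform_lln {Ω S κ : Type*} [MeasurableSpace Ω] [MeasurableSpace S]
    {P : Measure Ω} [IsProbabilityMeasure P] {Z : ℕ → Ω → S} (hZ : ∀ i, Measurable (Z i))
    (hident : ∀ i, P.map (Z i) = P.map (Z 0))
    (hind : ∀ i j, i ≠ j → IndepFun (Z i) (Z j) P)
    {φ G : κ → S → ℝ} {C ε : ℝ} (hφ : ∀ k, Measurable (φ k)) (hG : ∀ k, Measurable (G k))
    (hφC : ∀ k s, |φ k s| ≤ C) (hGC : ∀ k s, |G k s| ≤ C)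
    (J : Finset κ) (hJ : ∀ j ∈ J, ∫ ω, G j (Z 0 ω) ∂P ≤ ε) (𝓚 : Set κ)
    (hcover : ∀ k ∈ 𝓚, ∃ j ∈ J, ∀ i ω, |φ k (Z i ω) - φ j (Z i ω)| ≤ G j (Z i ω)) :
    ∃ R : ℕ → Ω → ℝ≥0∞, (∀ n, Measurable (R n)) ∧
      Tendsto (fun n => ∫⁻ ω, R n ω ∂P) atTop (𝓝 0) ∧
      ∀ n ω, ∀ k ∈ 𝓚, 1 ≤ n →
        ENNReal.ofReal |∑ i ∈ Finset.range n, (n : ℝ)⁻¹ * φ k (Z i ω) - ∫ ω, φ k (Z 0 ω) ∂P|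
          ≤ R n ω + ENNReal.ofReal (2 * ε) := by
  set avg : (S → ℝ) → ℕ → Ω → ℝ := fun ψ n ω =>
    ∑ i ∈ Finset.range n, (n : ℝ)⁻¹ * ψ (Z i ω) with havg
  have hmavg : ∀ ψ : S → ℝ, Measurable ψ → ∀ n, Measurable (avg ψ n) := fun ψ hψ n =>
    Finset.measurable_sum _ fun i _ => (hψ.comp (hZ i)).const_mul _
  have hint : ∀ ψ : S → ℝ, Measurable ψ → (∀ s, |ψ s| ≤ C) → ∀ i,
      Integrable (fun ω => ψ (Z i ω)) P := fun ψ hψ hC i =>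
    Integrable.of_bound (hψ.comp (hZ i)).aestronglyMeasurable C (ae_of_all _ fun ω => hC _)
  have hlln : ∀ ψ : S → ℝ, Measurable ψ → (∀ s, |ψ s| ≤ C) → Tendsto
      (fun n => ∫⁻ ω, ‖avg ψ n ω - ∫ ω, ψ (Z 0 ω) ∂P‖ₑ ∂P) atTop (𝓝 0) := by
    intro ψ hψ hC
    refine tendsto_of_tendsto_of_tendsto_of_le_of_le' tendsto_const_nhds (tendsto_sqrt_div (C ^ 2))
      (Eventually.of_forall fun _ => zero_le) ?_
    filter_upwards [eventually_ge_atTop 1] with n hn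
    refine lintegral_enorm_avg_sub_le (Y := fun i ω => ψ (Z i ω)) (fun i => ?_)
      (fun i j hij => (hind i j hij).comp hψ hψ) (fun i => ?_) (fun i => ?_) hn
    · exact MemLp.of_bound (hψ.comp (hZ i)).aestronglyMeasurable C (ae_of_all _ fun ω => hC _)
    · rw [← integral_map (hZ i).aemeasurable hψ.aestronglyMeasurable, hident,
        integral_map (hZ 0).aemeasurable hψ.aestronglyMeasurable]
    · have : ∫ ω, ψ (Z i ω) ^ 2 ∂P ≤ ∫ _, C ^ 2 ∂P := by
        refine integral_mono_of_nonneg (ae_of_all _ fun _ => sq_nonneg _) (integrable_const _)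
          (ae_of_all _ fun ω => ?_)
        have h := pow_le_pow_left₀ (abs_nonneg _) (hC (Z i ω)) 2
        rwa [sq_abs] at h
      simpa using this
  -- A finite sum over the net, so the bound is measurable although the supremum over `𝓚` need not
  -- be.
  refine ⟨fun n ω => ∑ j ∈ J, (‖avg (φ j) n ω - ∫ ω, φ j (Z 0 ω) ∂P‖ₑ +
    ‖avg (G j) n ω - ∫ ω, G j (Z 0 ω) ∂P‖ₑ), fun n => ?_, ?_, ?_⟩
  · exact Finset.measurable_sum _ fun j _ => (((hmavg _ (hφ j) n).sub_const _).enorm).add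
      (((hmavg _ (hG j) n).sub_const _).enorm)
  · have h : ∀ n, ∫⁻ ω, ∑ j ∈ J, (‖avg (φ j) n ω - ∫ ω, φ j (Z 0 ω) ∂P‖ₑ +
        ‖avg (G j) n ω - ∫ ω, G j (Z 0 ω) ∂P‖ₑ) ∂P =
        ∑ j ∈ J, (∫⁻ ω, ‖avg (φ j) n ω - ∫ ω, φ j (Z 0 ω) ∂P‖ₑ ∂P +
          ∫⁻ ω, ‖avg (G j) n ω - ∫ ω, G j (Z 0 ω) ∂P‖ₑ ∂P) := fun n => by
      have hm : ∀ j, Measurable fun ω => ‖avg (φ j) n ω - ∫ ω, φ j (Z 0 ω) ∂P‖ₑ +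
          ‖avg (G j) n ω - ∫ ω, G j (Z 0 ω) ∂P‖ₑ := fun j =>
        (((hmavg _ (hφ j) n).sub_const _).enorm).add (((hmavg _ (hG j) n).sub_const _).enorm)
      rw [lintegral_finsetSum _ fun j _ => hm j]
      exact Finset.sum_congr rfl fun j _ =>
        lintegral_add_left (((hmavg _ (hφ j) n).sub_const _).enorm) _
    simp only [h]
    have := tendsto_finsetSum J fun j _ =>
      (hlln _ (hφ j) (hφC j)).add (hlln _ (hG j) (hGC j))
    simpa using this
  · intro n ω k hk hn
    obtain ⟨j, hj, hjk⟩ := hcover k hk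
    have hmj := hJ j hj
    have e1 : |avg (φ k) n ω - avg (φ j) n ω| ≤ avg (G j) n ω := by
      simp only [havg]
      rw [← Finset.sum_sub_distrib]
      refine (Finset.abs_sum_le_sum_abs _ _).trans (Finset.sum_le_sum fun i _ => ?_)
      rw [← mul_sub, abs_mul, abs_of_nonneg (by positivity : (0 : ℝ) ≤ (n : ℝ)⁻¹)]
      exact mul_le_mul_of_nonneg_left (hjk i ω) (by positivity)
    have e2 : |∫ ω, φ k (Z 0 ω) ∂P - ∫ ω, φ j (Z 0 ω) ∂P| ≤ ∫ ω, G j (Z 0 ω) ∂P := by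
      rw [← integral_sub (hint _ (hφ k) (hφC k) 0) (hint _ (hφ j) (hφC j) 0)]
      exact (abs_integral_le_integral_abs).trans (integral_mono
        ((hint _ (hφ k) (hφC k) 0).sub (hint _ (hφ j) (hφC j) 0)).abs
        (hint _ (hG j) (hGC j) 0) fun ω => hjk 0 ω)
    have e3 := le_abs_self (avg (G j) n ω - ∫ ω, G j (Z 0 ω) ∂P)
    have e4 : |avg (φ k) n ω - ∫ ω, φ k (Z 0 ω) ∂P| ≤
        (|avg (φ j) n ω - ∫ ω, φ j (Z 0 ω) ∂P| + |avg (G j) n ω - ∫ ω, G j (Z 0 ω) ∂P|)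
          + 2 * ε := by
      rw [abs_le] at e1 e2 ⊢
      have e5 := abs_le.1 (le_refl |avg (φ j) n ω - ∫ ω, φ j (Z 0 ω) ∂P|)
      constructor <;> linarith [e1.1, e1.2, e2.1, e2.2, e5.1, e5.2]
    refine (ENNReal.ofReal_le_ofReal e4).trans (ENNReal.ofReal_add_le.trans ?_)
    gcongr
    rw [ENNReal.ofReal_add (abs_nonneg _) (abs_nonneg _), ← Real.norm_eq_abs, ← Real.norm_eq_abs,
      ofReal_norm, ofReal_norm]
    exact Finset.single_le_sum (f := fun j => ‖avg (φ j) n ω - ∫ ω, φ j (Z 0 ω) ∂P‖ₑ +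
      ‖avg (G j) n ω - ∫ ω, G j (Z 0 ω) ∂P‖ₑ) (fun _ _ => zero_le) hj

/-! ### Uniform convergence of the empirical measures of the surviving particles -/

theorem abs_exp_neg_sub_exp_neg_le {a b : ℝ} (ha : 0 ≤ a) (hb : 0 ≤ b) :
    |Real.exp (-a) - Real.exp (-b)| ≤ |a - b| := by
  have key : ∀ p q : ℝ, 0 ≤ p → Real.exp (-p) - Real.exp (-q) ≤ |p - q| := fun p q hp => by
    have h1 : Real.exp (-q) = Real.exp (-p) * Real.exp (p - q) := by
      rw [← Real.exp_add]; ring_nf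
    have h2 := Real.add_one_le_exp (p - q)
    have h3 : Real.exp (-p) ≤ 1 := Real.exp_le_one_iff.2 (by linarith)
    have h4 := Real.exp_pos (-p)
    have h5 := neg_abs_le (p - q)
    have h6 := abs_nonneg (p - q)
    rw [h1]
    nlinarith [mul_le_mul_of_nonneg_left h2 h4.le]
  rw [abs_le]
  have h1 := key a b ha
  have h2 := key b a hb
  rw [abs_sub_comm] at h2
  constructor <;> linarith

section AliveTest

variable {E : Type*} [NormedAddCommGroup E]

/-- The contribution at time `t` of a particle with path `q.1` and threshold `q.2`, for the clock
value `c` and the test function `f`. -/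
noncomputable def aliveTest (k : BLUnit E × ℝ≥0 × ℝ) (q : (ℝ≥0 → E) × ℝ) : ℝ :=
  if k.2.2 < q.2 then k.1.1 (q.1 k.2.1) else 0

/-- A bound for the variation of `aliveTest` around the time `k.2.1` and the clock value `k.2.2`. -/
noncomputable def aliveEnvelope (T : ℝ≥0) (δ ε R η Λ : ℝ) (k : BLUnit E × ℝ≥0 × ℝ)
    (q : (ℝ≥0 → E) × ℝ) : ℝ :=
  pathModulus T δ q.1 + (ε + 2 * min 1 (‖q.1 k.2.1‖ / R)) +
    ((Ioi (k.2.2 - η)).indicator 1 q.2 - (Ioi (k.2.2 + η)).indicator 1 q.2) +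
    (Ioi Λ).indicator 1 q.2

theorem abs_aliveTest_le (k : BLUnit E × ℝ≥0 × ℝ) (q : (ℝ≥0 → E) × ℝ) : |aliveTest k q| ≤ 1 := by
  unfold aliveTest
  split_ifs
  · exact k.1.2.1 _
  · simp

theorem indicator_one_Ioi_mem (a x : ℝ) :
    (Ioi a).indicator (1 : ℝ → ℝ) x ∈ Icc (0 : ℝ) 1 := by
  by_cases h : a < x <;> simp [h]

theorem abs_aliveEnvelope_le {T : ℝ≥0} {δ ε R η Λ : ℝ} (hε : 0 ≤ ε) (hR : 0 < R)
    (k : BLUnit E × ℝ≥0 × ℝ) (q : (ℝ≥0 → E) × ℝ) :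
    |aliveEnvelope T δ ε R η Λ k q| ≤ 6 + ε := by
  have h1 := pathModulus_nonneg T δ q.1
  have h2 := pathModulus_le_two T δ q.1
  have h3 : 0 ≤ min 1 (‖q.1 k.2.1‖ / R) := by positivity
  have h4 := min_le_left 1 (‖q.1 k.2.1‖ / R)
  have h5 := indicator_one_Ioi_mem (k.2.2 - η) q.2
  have h6 := indicator_one_Ioi_mem (k.2.2 + η) q.2
  have h7 := indicator_one_Ioi_mem Λ q.2
  unfold aliveEnvelope
  rw [abs_le]
  constructor <;> linarith [h5.1, h5.2, h6.1, h6.2, h7.1, h7.2]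

/-- If both tests see the particle alive, the difference comes from the displacement and from `f -
g`, which is small on the ball. If only one does, the threshold lies between the clock values, hence
within `η` of `c'` or above `Λ`. -/
theorem abs_aliveTest_sub_le {T : ℝ≥0} {δ ε R η Λ : ℝ} (hε : 0 ≤ ε) (hR : 0 < R) (hη : 0 < η)
    {b : ℝ≥0 → E} (hb : Continuous b) (x : ℝ) {f g : BLUnit E} {t t' : ℝ≥0} {c c' : ℝ}
    (ht : t ≤ T) (ht' : t' ≤ T) (hd : dist t t' < δ)
    (hfg : ∀ y ∈ Metric.closedBall 0 R, |f.1 y - g.1 y| ≤ ε)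
    (hc : |c - c'| < η ∨ Λ ≤ c ∧ c' = Λ) :
    |aliveTest (f, t, c) (b, x) - aliveTest (g, t', c') (b, x)| ≤
      aliveEnvelope T δ ε R η Λ (g, t', c') (b, x) := by
  have h1 : |f.1 (b t) - f.1 (b t')| ≤ pathModulus T δ b := by
    refine le_trans (le_min ?_ ?_) (le_pathModulus hb ht ht' hd)
    · have e1 := abs_le.1 (f.2.1 (b t))
      have e2 := abs_le.1 (f.2.1 (b t'))
      rw [abs_le]; constructor <;> linarith [e1.1, e1.2, e2.1, e2.2]
    · have := f.2.2.dist_le_mul (b t) (b t')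
      rwa [NNReal.coe_one, one_mul, dist_eq_norm, dist_eq_norm] at this
  have h2 : |f.1 (b t') - g.1 (b t')| ≤ ε + 2 * min 1 (‖b t'‖ / R) := by
    by_cases hy : ‖b t'‖ ≤ R
    · have : 0 ≤ min 1 (‖b t'‖ / R) := by positivity
      have := hfg (b t') (mem_closedBall_zero_iff.2 hy)
      linarith
    · rw [min_eq_left ((one_le_div hR).2 (not_le.1 hy).le)]
      have e1 := abs_le.1 (f.2.1 (b t'))
      have e2 := abs_le.1 (g.2.1 (b t'))
      rw [abs_le]; constructor <;> linarith [e1.1, e1.2, e2.1, e2.2]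
  have h3 : |f.1 (b t) - g.1 (b t')| ≤ pathModulus T δ b + (ε + 2 * min 1 (‖b t'‖ / R)) :=
    (abs_sub_le _ (f.1 (b t')) _).trans (add_le_add h1 h2)
  have h0 : 0 ≤ pathModulus T δ b + (ε + 2 * min 1 (‖b t'‖ / R)) := (abs_nonneg _).trans h3
  have h4 : 0 ≤ (Ioi (c' - η)).indicator (1 : ℝ → ℝ) x - (Ioi (c' + η)).indicator 1 x :=
    sub_nonneg.2 (indicator_le_indicator_of_subset (Ioi_subset_Ioi (by linarith))
      (fun _ => zero_le_one) x)
  have h5 := (indicator_one_Ioi_mem Λ x).1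
  have h6 : (c < x ∧ x ≤ c' ∨ c' < x ∧ x ≤ c) →
      1 ≤ (Ioi (c' - η)).indicator (1 : ℝ → ℝ) x - (Ioi (c' + η)).indicator 1 x +
        (Ioi Λ).indicator 1 x := by
    intro hx
    rcases hc with hc | ⟨hc, rfl⟩
    · rw [abs_lt] at hc
      have e1 : c' - η < x := by rcases hx with hx | hx <;> linarith [hx.1]
      have e2 : ¬ c' + η < x := by rcases hx with hx | hx <;> linarith [hx.2]
      simp only [indicator, mem_Ioi, e1, e2, if_true, if_false, Pi.one_apply] at h5 ⊢
      linarith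
    · have e1 : c' < x := by rcases hx with hx | hx <;> linarith [hx.1]
      rw [indicator_of_mem (mem_Ioi.2 e1), Pi.one_apply]
      linarith
  unfold aliveTest aliveEnvelope
  dsimp only
  by_cases hx : c < x <;> by_cases hx' : c' < x
  · rw [if_pos hx, if_pos hx']
    linarith
  · rw [if_pos hx, if_neg hx', sub_zero]
    have := f.2.1 (b t)
    linarith [h6 (Or.inl ⟨hx, not_lt.1 hx'⟩)]
  · rw [if_neg hx, if_pos hx', zero_sub, abs_neg]
    have := g.2.1 (b t')
    linarith [h6 (Or.inr ⟨hx', not_lt.1 hx⟩)]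
  · rw [if_neg hx, if_neg hx', sub_zero, abs_zero]
    linarith

variable [MeasurableSpace E] [BorelSpace E]

theorem measurable_aliveTest (k : BLUnit E × ℝ≥0 × ℝ) : Measurable (aliveTest k) :=
  Measurable.ite (measurableSet_lt measurable_const measurable_snd)
    (k.1.2.2.continuous.measurable.comp ((measurable_pi_apply _).comp measurable_fst))
    measurable_const

theorem measurable_aliveEnvelope [SecondCountableTopology E] (T : ℝ≥0) (δ ε R η Λ : ℝ)
    (k : BLUnit E × ℝ≥0 × ℝ) : Measurable (aliveEnvelope T δ ε R η Λ k) := by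
  have h1 : Measurable fun q : (ℝ≥0 → E) × ℝ => pathModulus T δ q.1 :=
    (measurable_pathModulus T δ).comp measurable_fst
  have h2 : ∀ a : ℝ, Measurable fun q : (ℝ≥0 → E) × ℝ => (Ioi a).indicator (1 : ℝ → ℝ) q.2 :=
    fun a => (measurable_one.indicator measurableSet_Ioi).comp measurable_snd
  have h3 : Measurable fun q : (ℝ≥0 → E) × ℝ => q.1 k.2.1 :=
    (measurable_pi_apply _).comp measurable_fst
  exact ((h1.add (measurable_const.add ((measurable_const.min
    (h3.norm.div_const R)).const_mul 2))).add ((h2 _).sub (h2 _))).add (h2 _)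

end AliveTest

namespace ParticleModel

variable {Ω E : Type*} [MeasurableSpace Ω] [NormedAddCommGroup E]
    [InnerProductSpace ℝ E] [FiniteDimensional ℝ E] [MeasurableSpace E] [BorelSpace E]
    {P : Measure Ω} {B : ℕ → ℝ≥0 → Ω → E} {X : ℕ → Ω → ℝ}

theorem measurable_pair (h : ParticleModel P B X) (i : ℕ) :
    Measurable fun ω => ((fun t => B i t ω : ℝ≥0 → E), X i ω) :=
  (measurable_pi_lambda _ (h.measurable_position i)).prodMk (h.measurable_threshold i)

theorem map_pair [IsProbabilityMeasure P] (h : ParticleModel P B X) (i : ℕ) :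
    P.map (fun ω => ((fun t => B i t ω : ℝ≥0 → E), X i ω)) =
      P.map (fun ω => ((fun t => B 0 t ω : ℝ≥0 → E), X 0 ω)) := by
  have hm : ∀ i, Measurable fun ω t => B i t ω := fun i =>
    measurable_pi_lambda _ (h.measurable_position i)
  rw [(indepFun_iff_map_prod_eq_prod_map_map (hm i).aemeasurable
      (h.measurable_threshold i).aemeasurable).1 (h.indep i),
    (indepFun_iff_map_prod_eq_prod_map_map (hm 0).aemeasurable
      (h.measurable_threshold 0).aemeasurable).1 (h.indep 0),
    h.map_path i, h.law_threshold, h.law_threshold]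

theorem integral_indicator_threshold (h : ParticleModel P B X) (i : ℕ) (a : ℝ) :
    ∫ ω, (Ioi a).indicator (1 : ℝ → ℝ) (X i ω) ∂P = Real.exp (-max a 0) := by
  rw [← integral_map (h.measurable_threshold i).aemeasurable
      (measurable_one.indicator measurableSet_Ioi).aestronglyMeasurable, h.law_threshold,
      integral_indicator_one measurableSet_Ioi, measureReal_expMeasure_Ioi]

theorem exists_integral_pathModulus_le [IsProbabilityMeasure P] (h : ParticleModel P B X) (T : ℝ≥0)
    {ε : ℝ} (hε : 0 < ε) : ∃ δ > 0, ∫ ω, pathModulus T δ (fun t => B 0 t ω) ∂P ≤ ε := by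
  have : ProperSpace E := FiniteDimensional.proper ℝ E
  have hlim : Tendsto (fun k : ℕ => ∫ ω, pathModulus T (1 / (k + 1 : ℝ)) (fun t => B 0 t ω) ∂P)
      atTop (𝓝 (∫ _, (0 : ℝ) ∂P)) := by
    refine tendsto_integral_of_dominated_convergence (fun _ => 2) (fun k => ?_)
      (integrable_const _) (fun k => ae_of_all _ fun ω => ?_)
      (ae_of_all _ fun ω => tendsto_pathModulus (h.continuous_path 0 ω))
    · exact ((measurable_pathModulus T _).comp
        (measurable_pi_lambda _ (h.measurable_position 0))).aestronglyMeasurable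
    · rw [Real.norm_of_nonneg (pathModulus_nonneg _ _ _)]
      exact pathModulus_le_two _ _ _
  rw [integral_zero] at hlim
  obtain ⟨k, hk⟩ := (hlim.eventually (ge_mem_nhds hε)).exists
  exact ⟨_, Nat.one_div_pos_of_nat, hk⟩

/-- Five contributions of at most `ε`: the modulus, the net error, the mass far out by a
first-moment bound, the threshold window by the Lipschitz bound on `e^{-c}`, and the tail `e^{-Λ}`.
-/
theorem integral_aliveEnvelope_le [IsProbabilityMeasure P] (h : ParticleModel P B X) {T : ℝ≥0}
    {δ ε R η Λ : ℝ} (hε : 0 < ε) (hR : 0 < R) (hη : 0 ≤ η) (hηε : 2 * η ≤ ε)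
    (hδ : ∫ ω, pathModulus T δ (fun t => B 0 t ω) ∂P ≤ ε)
    (hRε : 2 * (√(T : ℝ) * ∫ z, ‖z‖ ∂(stdGaussian E)) ≤ ε * R)
    (hΛ0 : 0 ≤ Λ) (hΛ : Real.exp (-Λ) ≤ ε) (k : BLUnit E × ℝ≥0 × ℝ) (hk : k.2.1 ≤ T) :
    ∫ ω, aliveEnvelope T δ ε R η Λ k (fun t => B 0 t ω, X 0 ω) ∂P ≤ 5 * ε := by
  have : ProperSpace E := FiniteDimensional.proper ℝ E
  have i1 : Integrable (fun ω => pathModulus T δ (fun t => B 0 t ω)) P :=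
    Integrable.of_bound ((measurable_pathModulus T _).comp
        (measurable_pi_lambda _ (h.measurable_position 0))).aestronglyMeasurable 2
      (ae_of_all _ fun ω => by
        rw [Real.norm_of_nonneg (pathModulus_nonneg _ _ _)]
        exact pathModulus_le_two _ _ _)
  have m2 : Measurable fun x : E => min 1 (‖x‖ / R) :=
    measurable_const.min (measurable_norm.div_const R)
  have i2 : Integrable (fun ω => min 1 (‖B 0 k.2.1 ω‖ / R)) P :=
    Integrable.of_bound (m2.comp (h.measurable_position 0 _)).aestronglyMeasurable 1
      (ae_of_all _ fun ω => by
        rw [Real.norm_of_nonneg (by positivity)]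
        exact min_le_left _ _)
  have i3 : ∀ a : ℝ, Integrable (fun ω => (Ioi a).indicator (1 : ℝ → ℝ) (X 0 ω)) P := fun a =>
    Integrable.of_bound ((measurable_one.indicator measurableSet_Ioi).comp
      (h.measurable_threshold 0)).aestronglyMeasurable 1 (ae_of_all _ fun ω => by
        have := indicator_one_Ioi_mem a (X 0 ω)
        rw [Real.norm_of_nonneg this.1]
        exact this.2)
  have e2 : ∫ ω, min 1 (‖B 0 k.2.1 ω‖ / R) ∂P ≤
      √(T : ℝ) * (∫ z, ‖z‖ ∂(stdGaussian E)) / R := by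
    rw [h.integral_position m2, ← integral_const_mul, ← integral_div]
    have hz : Integrable (fun z : E => √(T : ℝ) * ‖z‖ / R) (stdGaussian E) := by
      simpa using ((integrable_norm_pow_stdGaussian (E := E) 1).const_mul √(T : ℝ)).div_const R
    refine integral_mono_of_nonneg (ae_of_all _ fun z => by positivity) hz
      (ae_of_all _ fun z => (min_le_right _ _).trans ?_)
    rw [norm_smul, Real.norm_of_nonneg (Real.sqrt_nonneg _)]
    have : √(k.2.1 : ℝ) ≤ √(T : ℝ) := Real.sqrt_le_sqrt (by exact_mod_cast hk)
    exact div_le_div_of_nonneg_right (mul_le_mul_of_nonneg_right this (norm_nonneg z)) hR.le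
  have e2' : 2 * ∫ ω, min 1 (‖B 0 k.2.1 ω‖ / R) ∂P ≤ ε := by
    refine (mul_le_mul_of_nonneg_left e2 zero_le_two).trans ?_
    rw [← mul_div_assoc, div_le_iff₀ hR]
    exact hRε
  have e3 : Real.exp (-max (k.2.2 - η) 0) - Real.exp (-max (k.2.2 + η) 0) ≤ ε := by
    refine (le_abs_self _).trans ((abs_exp_neg_sub_exp_neg_le (le_max_right _ _)
      (le_max_right _ _)).trans ((abs_max_sub_max_le_abs _ _ _).trans ?_))
    rw [abs_le]; constructor <;> linarith
  unfold aliveEnvelope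
  dsimp only
  have j1 : Integrable (fun ω => ε + 2 * min 1 (‖B 0 k.2.1 ω‖ / R)) P :=
    (integrable_const ε).add (i2.const_mul 2)
  have j2 : Integrable (fun ω => pathModulus T δ (fun t => B 0 t ω) +
      (ε + 2 * min 1 (‖B 0 k.2.1 ω‖ / R))) P := i1.add j1
  have j3 : Integrable (fun ω => (Ioi (k.2.2 - η)).indicator (1 : ℝ → ℝ) (X 0 ω) -
      (Ioi (k.2.2 + η)).indicator 1 (X 0 ω)) P := (i3 _).sub (i3 _)
  have j4 : Integrable (fun ω => pathModulus T δ (fun t => B 0 t ω) +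
      (ε + 2 * min 1 (‖B 0 k.2.1 ω‖ / R)) + ((Ioi (k.2.2 - η)).indicator (1 : ℝ → ℝ) (X 0 ω) -
      (Ioi (k.2.2 + η)).indicator 1 (X 0 ω))) P := j2.add j3
  rw [integral_add j4 (i3 _), integral_add j2 j3, integral_add i1 j1,
    integral_add (integrable_const ε) (i2.const_mul 2), integral_sub (i3 _) (i3 _),
    integral_const_mul, h.integral_indicator_threshold, h.integral_indicator_threshold,
    h.integral_indicator_threshold, max_eq_left hΛ0, integral_const, probReal_univ, one_smul]
  linarith

/-- The Glivenko–Cantelli theorem for the surviving particles, uniformly in the time and in the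
value of the clock. -/
theorem exists_uniform_lln [IsProbabilityMeasure P] (h : ParticleModel P B X) (T : ℝ≥0) {ε : ℝ}
    (hε : 0 < ε) : ∃ R : ℕ → Ω → ℝ≥0∞, (∀ n, Measurable (R n)) ∧
      Tendsto (fun n => ∫⁻ ω, R n ω ∂P) atTop (𝓝 0) ∧
      ∀ n, 1 ≤ n → ∀ ω (f : BLUnit E) (t c : ℝ), t ∈ Icc (0 : ℝ) T → 0 ≤ c →
        ENNReal.ofReal |(∑ i ∈ Finset.range n,
            if c < X i ω then (n : ℝ)⁻¹ * f.1 (B i t.toNNReal ω) else 0) -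
          (∫ z, f.1 (√t • z) ∂(stdGaussian E)) * Real.exp (-c)| ≤ R n ω + ENNReal.ofReal ε := by
  have : ProperSpace E := FiniteDimensional.proper ℝ E
  -- The envelopes have mean at most `5 * e`, which the law of large numbers doubles.
  set e : ℝ := ε / 10 with he_def
  have he : 0 < e := by positivity
  obtain ⟨δ, hδ0, hδ⟩ := h.exists_integral_pathModulus_le T he
  -- The `+ 1` keeps the radius positive when the first moment or `T` vanishes.
  set ρ : ℝ := 2 * (√(T : ℝ) * ∫ z, ‖z‖ ∂(stdGaussian E)) / e + 1 with hρ_def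
  have hM : 0 ≤ ∫ z, ‖z‖ ∂(stdGaussian E) := integral_nonneg fun _ => norm_nonneg _
  have hρ : 0 < ρ := by positivity
  have hρe : 2 * (√(T : ℝ) * ∫ z, ‖z‖ ∂(stdGaussian E)) ≤ e * ρ := by
    rw [hρ_def, mul_add, mul_div_cancel₀ _ he.ne']
    linarith
  set Λ : ℝ := 1 / e with hΛ_def
  have hΛ0 : 0 ≤ Λ := by positivity
  have hΛ : Real.exp (-Λ) ≤ e := by
    rw [Real.exp_neg, inv_le_comm₀ (Real.exp_pos _) he, ← one_div]
    linarith [Real.add_one_le_exp Λ]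
  obtain ⟨F, hF, hFnet⟩ := exists_finite_net_BLUnit (isCompact_closedBall (0 : E) ρ) he
  obtain ⟨D, hDT, hD, hDnet⟩ :=
    finite_cover_balls_of_compact (isCompact_Icc (a := (0 : ℝ≥0)) (b := T)) hδ0
  obtain ⟨N, -, hN, hNnet⟩ :=
    finite_cover_balls_of_compact (isCompact_Icc (a := (0 : ℝ)) (b := Λ)) (half_pos he)
  -- The extra point `Λ` represents all clock values above `Λ`, since the clock has no a priori
  -- bound.
  set J := (hF.prod (hD.prod (hN.insert Λ))).toFinset with hJ
  obtain ⟨R, hR1, hR2, hR3⟩ := _root_.exists_uniform_lln (P := P)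
    (Z := fun i ω => ((fun t => B i t ω : ℝ≥0 → E), X i ω)) h.measurable_pair h.map_pair
    h.indep_pair (φ := aliveTest) (G := aliveEnvelope T δ e ρ (e / 2) Λ) (C := 6 + e) (ε := 5 * e)
    measurable_aliveTest (measurable_aliveEnvelope T δ e ρ (e / 2) Λ)
    (fun k s => (abs_aliveTest_le k s).trans (by linarith)) (abs_aliveEnvelope_le he.le hρ) J
    (fun j hj => h.integral_aliveEnvelope_le he hρ (half_pos he).le (by linarith) hδ hρe hΛ0 hΛ j
      (hDT ((hF.prod (hD.prod (hN.insert Λ))).mem_toFinset.1 hj).2.1).2)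
    {k | k.2.1 ≤ T ∧ 0 ≤ k.2.2} (fun k hk => by
      obtain ⟨f, t, c⟩ := k
      obtain ⟨g, hg, hfg⟩ := hFnet f
      obtain ⟨t', ht', htt'⟩ := mem_iUnion₂.1 (hDnet ⟨zero_le, hk.1⟩)
      obtain ⟨c', hc', hcc'⟩ : ∃ c' ∈ insert Λ N, |c - c'| < e / 2 ∨ Λ ≤ c ∧ c' = Λ := by
        rcases le_total Λ c with hc | hc
        · exact ⟨Λ, mem_insert _ _, Or.inr ⟨hc, rfl⟩⟩
        · obtain ⟨c', hc', hcc'⟩ := mem_iUnion₂.1 (hNnet ⟨hk.2, hc⟩)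
          exact ⟨c', mem_insert_of_mem _ hc', Or.inl hcc'⟩
      refine ⟨(g, t', c'), (hF.prod (hD.prod (hN.insert Λ))).mem_toFinset.2 ⟨hg, ht', hc'⟩,
        fun i ω => ?_⟩
      exact abs_aliveTest_sub_le he.le hρ (half_pos he) (h.continuous_path i ω) _ hk.1
        (hDT ht').2 htt' hfg hcc')
  refine ⟨R, hR1, hR2, fun n hn ω f t c ht hc => ?_⟩
  have key := hR3 n ω (f, t.toNNReal, c) ⟨Real.toNNReal_le_iff_le_coe.2 ht.2, hc⟩ hn
  have e1 : ∫ ω, aliveTest (f, t.toNNReal, c) (fun t => B 0 t ω, X 0 ω) ∂P =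
      (∫ z, f.1 (√t • z) ∂(stdGaussian E)) * Real.exp (-c) :=
    h.integral_alive f.2.2.continuous.measurable 0 ht.1 hc
  have e2 : ∑ i ∈ Finset.range n, (n : ℝ)⁻¹ * aliveTest (f, t.toNNReal, c)
      (fun t => B i t ω, X i ω) = ∑ i ∈ Finset.range n,
        if c < X i ω then (n : ℝ)⁻¹ * f.1 (B i t.toNNReal ω) else 0 :=
    Finset.sum_congr rfl fun i _ => by simp [aliveTest]
  rw [e1, e2] at key
  convert key using 3
  rw [he_def]; ring

end ParticleModel

/-! ### The limiting flow of measures -/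

section LimitFlow

variable {E : Type*} [NormedAddCommGroup E] [InnerProductSpace ℝ E] [FiniteDimensional ℝ E]
  [MeasurableSpace E] [BorelSpace E] {ζ : E → ℝ} {K : ℝ}

theorem integral_map_smul_stdGaussian {f : E → ℝ} (hf : Continuous f) (t : ℝ) :
    ∫ y, f y ∂((stdGaussian E).map fun z => √t • z) = ∫ z, f (√t • z) ∂(stdGaussian E) :=
  integral_map (by fun_prop) hf.aestronglyMeasurable

theorem limitMeasure_eq (hζ : Continuous ζ) {w : ℝ → Measure E}
    (hw : ∀ t, w t = (stdGaussian E).map fun z => √t • z) (t : ℝ) :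
    limitMeasure ζ w t =
      ENNReal.ofReal (gaussianSurvival ζ t) • (stdGaussian E).map fun z => √t • z := by
  simp only [limitMeasure, survivalFactor, hw, integral_map_smul_stdGaussian hζ]
  rfl

theorem limitMeasure_eq_withDensity (hζ : Continuous ζ) (hζ0 : ∀ y, 0 ≤ ζ y) {w : ℝ → Measure E}
    (hw : ∀ t, w t = (stdGaussian E).map fun z => √t • z) {t : ℝ} (ht : 0 < t) :
    limitMeasure ζ w t = volume.withDensity fun x =>
      ENNReal.ofReal (gaussianSurvival ζ t * heatKernel E t x) := by
  have hm : Measurable fun x : E => ENNReal.ofReal (heatKernel E t x) :=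
    (ENNReal.continuous_ofReal.comp (continuous_heatKernel t)).measurable
  rw [limitMeasure_eq hζ hw, map_smul_stdGaussian ht, ← withDensity_smul _ hm]
  congr 1
  ext x
  rw [ENNReal.ofReal_mul (gaussianSurvival_pos hζ0 ht.le).le]
  rfl

/-- The limit of the particle systems. -/
noncomputable def limitFlow (hζ0 : ∀ y, 0 ≤ ζ y) {T : ℝ≥0} (t : Icc (0 : ℝ) T) : SubProb E :=
  SubProb.ofMeasure
    (ENNReal.ofReal (gaussianSurvival ζ t) • (stdGaussian E).map fun z => √(t : ℝ) • z) <| by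
    have : IsProbabilityMeasure ((stdGaussian E).map fun z => √(t : ℝ) • z) :=
      Measure.isProbabilityMeasure_map (by fun_prop)
    rw [Measure.smul_apply, measure_univ, smul_eq_mul, mul_one]
    exact ENNReal.ofReal_le_one.2 (gaussianSurvival_le_one hζ0 t.2.1)

theorem integral_limitFlow (hζ0 : ∀ y, 0 ≤ ζ y) {T : ℝ≥0} (t : Icc (0 : ℝ) T) {f : E → ℝ}
    (hf : Continuous f) : ∫ y, f y ∂(limitFlow hζ0 t).toMeasure =
      gaussianSurvival ζ t * ∫ z, f (√(t : ℝ) • z) ∂(stdGaussian E) := by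
  rw [limitFlow, SubProb.toMeasure_ofMeasure, integral_smul_measure,
    integral_map_smul_stdGaussian hf, ENNReal.toReal_ofReal (gaussianSurvival_pos hζ0 t.2.1).le,
    smul_eq_mul]

theorem continuous_limitFlow (hζ : Continuous ζ) (hζ0 : ∀ y, 0 ≤ ζ y) (hK : QuadraticGrowth ζ K)
    (T : ℝ≥0) : Continuous (limitFlow hζ0 (T := T)) := by
  refine continuous_iff_continuousAt.2 fun t => SubProb.tendsto_iff.2 fun f => ?_
  simp only [integral_limitFlow hζ0 _ f.continuous]
  have h1 : Continuous fun t : Icc (0 : ℝ) T => gaussianSurvival ζ t :=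
    (continuousOn_gaussianSurvival hζ hζ0 hK).comp_continuous continuous_subtype_val
      fun t => t.2.1
  have h2 : Continuous fun t : Icc (0 : ℝ) T => ∫ z, f (√(t : ℝ) • z) ∂(stdGaussian E) :=
    ((quadraticGrowth_of_bounded f).continuous_integral_scaled f.continuous).comp
      continuous_subtype_val
  exact (h1.mul h2).tendsto t

/-- A continuous path, as an element of the Skorokhod space. -/
def SkorokhodSpace.ofContinuous {T : ℝ≥0} {S : Type*} [TopologicalSpace S]
    {m : Icc (0 : ℝ) T → S} (hm : Continuous m) : SkorokhodSpace T S where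
  toFun := m
  right_cont _ := hm.continuousWithinAt
  left_lim t := ⟨m t, hm.continuousWithinAt⟩

/-- The identity is an admissible time change. -/
theorem SkorokhodSpace.edist_le_of_forall {T : ℝ≥0} {S : Type*} [TopologicalSpace S] [EDist S]
    {x y : SkorokhodSpace T S} {r : ℝ≥0∞} (h : ∀ t, edist (x.toFun t) (y.toFun t) ≤ r) :
    edist x y ≤ r := by
  refine (iInf_le _ (OrderIso.refl _)).trans (max_le (iSup_le fun t => ?_) (iSup_le h))
  simp

/-- Since `hr` is uniform in `c`, it applies at the random value `A t`. Replacing `e^{-A}` by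
`e^{-Λ}` then costs at most `|A - Λ|`, as the test functions are bounded by `1`. -/
theorem edist_killing_limitFlow_le (hζ : Continuous ζ) (hζ0 : ∀ y, 0 ≤ ζ y)
    (hK : QuadraticGrowth ζ K) {n : ℕ} {b : ℕ → ℝ≥0 → E} (hb : ∀ i, Continuous (b i))
    {x : ℕ → ℝ} {T : ℝ≥0} {m : Icc (0 : ℝ) T → SubProb E} (hm : SolvesKilling ζ n b x m)
    {r : ℝ≥0∞} (hr : ∀ (f : BLUnit E) (t c : ℝ), t ∈ Icc (0 : ℝ) T → 0 ≤ c →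
        ENNReal.ofReal |(∑ i ∈ Finset.range n,
            if c < x i then (n : ℝ)⁻¹ * f.1 (b i t.toNNReal) else 0) -
          (∫ z, f.1 (√t • z) ∂(stdGaussian E)) * Real.exp (-c)| ≤ r) (t : Icc (0 : ℝ) T) :
    edist (m t) (limitFlow hζ0 t) ≤ r + clockError T ζ n b x := by
  obtain ⟨A, hA⟩ := exists_isKillingClock hζ hζ0 n hb x
  refine iSup_le fun f => ?_
  have hA0 := hA.nonneg hζ0 t.2.1
  have hl0 := limitClock_nonneg hζ0 t.2.1
  rw [hm.toMeasure_eq hζ0 (continuous_particleRate hζ hb) hA t, integral_aliveMeasure,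
    integral_limitFlow hζ0 t f.2.2.continuous, ← exp_neg_limitClock hζ0 t.2.1]
  set M := ∫ z, f.1 (√(t : ℝ) • z) ∂(stdGaussian E) with hM
  have hM1 : |M| ≤ 1 := by
    have := norm_integral_le_of_norm_le_const (μ := stdGaussian E) (C := 1)
      (f := fun z => f.1 (√(t : ℝ) • z)) (ae_of_all _ fun z => f.2.1 _)
    simpa using this
  have h1 : |M * Real.exp (-A t) - Real.exp (-limitClock ζ t) * M| ≤
      |A t - limitClock ζ t| := by
    rw [mul_comm _ M, ← mul_sub, abs_mul]
    exact (mul_le_of_le_one_left (abs_nonneg _) hM1).trans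
      (abs_exp_neg_sub_exp_neg_le hA0 hl0)
  refine (ENNReal.ofReal_le_ofReal ((abs_sub_le _ (M * Real.exp (-A t)) _).trans
    (add_le_add_right h1 _))).trans (ENNReal.ofReal_add_le.trans (add_le_add ?_ ?_))
  · exact hr f t (A t) t.2 hA0
  · exact hA.abs_sub_limitClock_le hζ hζ0 hK hb t.2

end LimitFlow

/-! ### Measurability of the solutions and convergence in probability -/

namespace ParticleModel

variable {Ω E : Type*} [MeasurableSpace Ω] [NormedAddCommGroup E]
    [InnerProductSpace ℝ E] [FiniteDimensional ℝ E] [MeasurableSpace E] [BorelSpace E]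
    {P : Measure Ω} {B : ℕ → ℝ≥0 → Ω → E} {X : ℕ → Ω → ℝ}
    {ζ : E → ℝ} {K : ℝ} {T : ℝ≥0}

theorem aemeasurable_of_solvesKilling (h : ParticleModel P B X) (hζ : Continuous ζ)
    (hζ0 : ∀ y, 0 ≤ ζ y) {n : ℕ} {m : Ω → Icc (0 : ℝ) T → SubProb E}
    (hm : ∀ᵐ ω ∂P, SolvesKilling ζ n (fun i t => B i t ω) (fun i => X i ω) (m ω))
    (t : Icc (0 : ℝ) T) : AEMeasurable (fun ω => (m ω t).toMeasure) P := by
  obtain ⟨A, hA1, hA2⟩ := h.exists_measurable_clock hζ hζ0 n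
  refine ⟨fun ω => aliveMeasure n (fun i => B i (t : ℝ).toNNReal ω) (fun i => A ω t < X i ω),
    measurable_aliveMeasure n (fun i => h.measurable_position i _)
      (fun i => measurableSet_lt (hA2 t t.2.1) (h.measurable_threshold i)), ?_⟩
  filter_upwards [hm] with ω hω
  exact hω.toMeasure_eq hζ0 (continuous_particleRate hζ fun i => h.continuous_path i ω) (hA1 ω) t

/-- Markov's inequality is applied to the measurable majorant `D n`, so no measurability of the
Skorokhod distance is required. -/
theorem tendstoInMeasure_limitFlow [IsProbabilityMeasure P] (h : ParticleModel P B X)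
    (hζ : Continuous ζ) (hζ0 : ∀ y, 0 ≤ ζ y) (hK : QuadraticGrowth ζ K)
    {μn : ℕ → Ω → SkorokhodSpace T (SubProb E)}
    (hμn : ∀ n, 1 ≤ n → ∀ᵐ ω ∂P,
      SolvesKilling ζ n (fun i t => B i t ω) (fun i => X i ω) (μn n ω).toFun) :
    TendstoInMeasure P μn atTop
      fun _ => SkorokhodSpace.ofContinuous (continuous_limitFlow hζ hζ0 hK T) := by
  refine tendstoInMeasure_of_ne_top fun ε hε hε_top => ?_
  -- Half of `ε` absorbs the deterministic net error, the other half is the level in Markov's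
  -- inequality.
  have hr0 : 0 < ε.toReal / 2 := half_pos (ENNReal.toReal_pos hε.ne' hε_top)
  set r : ℝ := ε.toReal / 2 with hr
  have hrr : ε = ENNReal.ofReal r + ENNReal.ofReal r := by
    rw [← ENNReal.ofReal_add hr0.le hr0.le, hr, add_halves, ENNReal.ofReal_toReal hε_top]
  obtain ⟨R, hR1, hR2, hR3⟩ := h.exists_uniform_lln T hr0
  set D : ℕ → Ω → ℝ≥0∞ := fun n ω =>
    R n ω + clockError T ζ n (fun i t => B i t ω) (fun i => X i ω) with hD
  have hDm : ∀ n, AEMeasurable (D n) P := fun n =>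
    (hR1 n).aemeasurable.add (h.aemeasurable_clockError hζ hζ0 hK T n)
  have hlim : Tendsto (fun n => ∫⁻ ω, D n ω ∂P) atTop (𝓝 0) := by
    have h1 : Tendsto (fun n => ∫⁻ ω, clockError T ζ n (fun i t => B i t ω) (fun i => X i ω) ∂P)
        atTop (𝓝 0) := by
      have h2 := ENNReal.Tendsto.mul_const (b := (T : ℝ≥0∞))
        (tendsto_sqrt_div (∫ z : E, (K * (1 + T * ‖z‖ ^ 2)) ^ 2 ∂(stdGaussian E)))
        (Or.inr ENNReal.coe_ne_top)
      rw [zero_mul] at h2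
      refine tendsto_of_tendsto_of_tendsto_of_le_of_le' tendsto_const_nhds h2
        (Eventually.of_forall fun _ => zero_le) ?_
      filter_upwards [eventually_ge_atTop 1] with n hn
      exact h.lintegral_clockError_le hζ hζ0 hK T hn
    have h3 := hR2.add h1
    rw [add_zero] at h3
    exact h3.congr fun n => (lintegral_add_left (hR1 n) _).symm
  have hbound : ∀ n, 1 ≤ n → P {ω | ε ≤ edist (μn n ω)
      (SkorokhodSpace.ofContinuous (continuous_limitFlow hζ hζ0 hK T))} ≤
      (∫⁻ ω, D n ω ∂P) / ENNReal.ofReal r := by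
    intro n hn
    refine le_trans (measure_mono_ae ?_)
      (meas_ge_le_lintegral_div (hDm n) (ENNReal.ofReal_pos.2 hr0).ne' ENNReal.ofReal_ne_top)
    filter_upwards [hμn n hn] with ω hω hle
    have h1 := SkorokhodSpace.edist_le_of_forall (x := μn n ω)
      (y := SkorokhodSpace.ofContinuous (continuous_limitFlow hζ hζ0 hK T))
      (edist_killing_limitFlow_le hζ hζ0 hK (fun i => h.continuous_path i ω) hω (hR3 n hn ω))
    have h2 := (show ε ≤ _ from hle).trans h1
    rw [hrr, add_right_comm] at h2
    exact ENNReal.le_of_add_le_add_right ENNReal.ofReal_ne_top h2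
  have h0 := ENNReal.Tendsto.div_const hlim (b := ENNReal.ofReal r)
    (Or.inr (ENNReal.ofReal_pos.2 hr0).ne')
  rw [ENNReal.zero_div] at h0
  refine tendsto_of_tendsto_of_tendsto_of_le_of_le' tendsto_const_nhds h0
    (Eventually.of_forall fun _ => zero_le) ?_
  filter_upwards [eventually_ge_atTop 1] with n hn using hbound n hn

end ParticleModel

theorem theorem2p1 {Ω : Type*} [MeasurableSpace Ω] (P : Measure Ω) [IsProbabilityMeasure P]
    (d : ℕ) (T : ℝ≥0)
    -- the killing function, continuous and of sub-quadratic growth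
    (ζ : EuclideanSpace ℝ (Fin d) → ℝ) (hζ : Continuous ζ)
    (p C : ℝ) (hp0 : 0 ≤ p) (hp2 : p < 2) (hC : 0 < C)
    (hζ_bound : ∀ x, 0 ≤ ζ x ∧ ζ x ≤ C * (1 + ‖x‖ ^ p))
    -- i.i.d. standard Brownian motions
    (B : ℕ → ℝ≥0 → Ω → EuclideanSpace ℝ (Fin d))
    (hB_meas : ∀ i t, Measurable (B i t))
    (hB : ∀ i, IsStdBrownian (B i) P)
    (hB_indep : iIndepFun (fun i ω (t : ℝ≥0) => B i t ω) P)
    -- i.i.d. exponential variables of rate 1, independent of the Brownian motions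
    (X : ℕ → Ω → ℝ)
    (hX_meas : ∀ i, Measurable (X i))
    (hX : ∀ i, HasLaw (X i) (expMeasure 1) P)
    (hX_indep : iIndepFun X P)
    (hBX : IndepFun (fun ω (i : ℕ) (t : ℝ≥0) => B i t ω) (fun ω (i : ℕ) => X i ω) P) :
    -- almost surely the equation for the particle system has exactly one solution,
    -- and it lies in the Skorokhod space
    (∀ n : ℕ, 1 ≤ n → ∀ᵐ ω ∂P,
      ∃ m : SkorokhodSpace T (SubProb (EuclideanSpace ℝ (Fin d))),
        SolvesKilling ζ n (fun i t => B i t ω) (fun i => X i ω) m.toFun ∧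
        ∀ m' : Icc (0 : ℝ) T → SubProb (EuclideanSpace ℝ (Fin d)),
          SolvesKilling ζ n (fun i t => B i t ω) (fun i => X i ω) m' → m' = m.toFun) ∧
    -- `a(t)` is well defined
    (∀ t : ℝ, 0 ≤ t → Integrable ζ (marginalLaw P (B 0) t)) ∧
    (∀ t : ℝ, 0 ≤ t → IntervalIntegrable (fun s => ∫ x, ζ x ∂(marginalLaw P (B 0) s)) volume 0 t) ∧
    -- convergence in probability in the Skorokhod space to the continuous path `a(t) Law(B(t))`
    (∃ μ : SkorokhodSpace T (SubProb (EuclideanSpace ℝ (Fin d))),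
      (∀ t, (μ.toFun t).toMeasure = limitMeasure ζ (marginalLaw P (B 0)) t) ∧ Continuous μ.toFun ∧
      ∀ μn : ℕ → Ω → SkorokhodSpace T (SubProb (EuclideanSpace ℝ (Fin d))),
        (∀ n : ℕ, 1 ≤ n → ∀ᵐ ω ∂P,
          SolvesKilling ζ n (fun i t => B i t ω) (fun i => X i ω) (μn n ω).toFun) →
        (∀ n : ℕ, 1 ≤ n → ∀ t, AEMeasurable (fun ω => ((μn n ω).toFun t).toMeasure) P) ∧
        TendstoInMeasure P μn atTop (fun _ => μ)) ∧
    -- the density of the limit solves the nonlocal reaction-diffusion equation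
    (∃ u : ℝ → EuclideanSpace ℝ (Fin d) → ℝ,
      (∀ t, 0 < t → limitMeasure ζ (marginalLaw P (B 0)) t = volume.withDensity (fun x => ENNReal.ofReal (u t x))) ∧
      SolvesReactionDiffusion ζ u) := by
  have hζ0 : ∀ y, 0 ≤ ζ y := fun y => (hζ_bound y).1
  have hK : QuadraticGrowth ζ (2 * C) := quadraticGrowth_of_rpow hp0 hp2 hC hζ_bound
  have hw : ∀ t, marginalLaw P (B 0) t = (stdGaussian _).map fun z => √t • z :=
    fun t => (hB 0).marginalLaw_eq t
  -- Everything is proved for the everywhere continuous modification and carried back along `hpath`.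
  obtain ⟨B', hmodel, hae⟩ :=
    exists_particleModel hB_meas hB hB_indep hX_meas hX hX_indep hBX
  have hpath : ∀ᵐ ω ∂P, (fun i t => B' i t ω) = fun i t => B i t ω := by
    filter_upwards [hae] with ω hω
    exact funext fun i => funext (hω i)
  refine ⟨fun n _ => ?_, fun t _ => ?_, fun t _ => ?_,
    ⟨SkorokhodSpace.ofContinuous (continuous_limitFlow hζ hζ0 hK T),
      fun t => (limitMeasure_eq hζ hw t).symm, continuous_limitFlow hζ hζ0 hK T,
      fun μn hμn => ?_⟩,
    ⟨fun t x => gaussianSurvival ζ t * heatKernel _ t x,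
      fun t ht => limitMeasure_eq_withDensity hζ hζ0 hw ht,
      solvesReactionDiffusion_heatKernel hζ hζ0 hK⟩⟩
  · filter_upwards [hpath] with ω hω
    rw [← hω]
    exact existsUnique_solvesKilling T n hζ hζ0 (fun i => hmodel.continuous_path i ω) _
  · rw [hw]
    exact (integrable_map_measure hζ.aestronglyMeasurable (by fun_prop)).2
      (hK.integrable_scaled hζ t)
  · simp only [hw, integral_map_smul_stdGaussian hζ]
    exact (continuous_gaussianRate hζ hK).intervalIntegrable 0 t
  · have hμn' : ∀ n, 1 ≤ n → ∀ᵐ ω ∂P,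
        SolvesKilling ζ n (fun i t => B' i t ω) (fun i => X i ω) (μn n ω).toFun := by
      intro n hn
      filter_upwards [hμn n hn, hpath] with ω h1 h2
      rwa [h2]
    exact ⟨fun n hn t => hmodel.aemeasurable_of_solvesKilling hζ hζ0 (hμn' n hn) t,
      hmodel.tendstoInMeasure_limitFlow hζ hζ0 hK hμn'⟩
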